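/- Let $n\ge 2$ and $d=n+1\ge 3$. Let $Q$ be a Euclidean ordered field (a linearly ordered field in which positive elements have square roots), let $|\cdot|$ be the Euclidean length on $Q^n$, and write $p=(p_\tau,p_\sigma)\in Q^d$ with $p_\tau\in Q$, $p_\sigma\in Q^{n}$. Let $B$ be a set (bodies), let $\mathrm{IOb}\subseteq \mathrm{Ob}\subseteq B$ ((inertial) observers) and $\mathrm{Ph}\subseteq B$ (photons), let $W\subseteq \mathrm{Ob}\times B\times Q^d$ ("observer $m$ coordinatizes body $b$ at $p$"), and let $M\subseteq B\times Q^d\times Q\times B$ ("the relativistic mass of $b$ at $p$ is $x$ according to $k$"). Notation. $\mathrm{ev}_m(p)=\{b: W(m,b,p)\}$, $\mathrm{wl}_m(b)=\{p: W(m,b,p)\}$, $\mathrm{Ev}_m=\{\mathrm{ev}_m(p)\neq\emptyset : p\in Q^d\}$; $w^k_m(p)$ is the unique $q$ with $\mathrm{ev}_k(p)=\mathrm{ev}_m(q)\neq\emptyset$. Equations mean that both sides are defined and equal. $m_k(b,p)$ is the unique $x$ with $M(b,p,x,k)$; $m_k(b)$ is the common value of $m_k(b,p)$ for $p\in \mathrm{wl}_k(b)$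 (if it exists). $\mathrm{loc}^b_k(t)$ is the unique $p\in\mathrm{wl}_k(b)$ with $p_\tau=t$. The velocity of $b$ at $t$ according to $k$ is the ($\varepsilon$-$\delta$, unique) derivative at $t$ of the partial function $t\mapsto \mathrm{loc}^b_k(t)_\sigma$, its length is the speed $v_k^b(t)$; if the velocity is constant where defined, its value is $\mathbf v_k(b)$ and $v_k(b)=|\mathbf v_k(b)|$. A body $b$ is at rest according to $k\in\mathrm{Ob}$ if $v^b_k(t)$ is defined for some $t$ and is $0$ whenever it is defined. The rest mass $m_0(b)$ is defined and equals $\lambda$ iff some observer $k$ according to which $b$ is at rest satisfies $m_k(b,p)=\lambda$ for all $p\in \mathrm{wl}_k(b)$, and every observer according to which $b$ is at rest does so. A line segment is a convex subset of a line with at least two elements; $b$ is an inertial body if $\mathrm{wl}_k(b)$ is a line segment for every $k\in\mathrm{IOb}$. $\mathrm{in}_k(q)$ (resp. $\mathrm{out}_k(q)$) is the set of bodies $b$ with $q\in\mathrm{wl}_k(b)$ such that every other $p\in\mathrm{wl}_k(b)$ has $p_\tau<q_\tau$ (resp. $p_\tau>q_\tau$). $\mathrm{inecoll}_k(b,c:d)$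 means that $b\ne c$ and for some $q$, $\mathrm{in}_k(q)=\{b,c\}$ and $\mathrm{out}_k(q)=\{d\}$. $\mathrm{cen}_k(b,c)$ is the set of the centers of mass at the instants $t$ of $b,c$ placed at $\mathrm{loc}_k^b(t),\mathrm{loc}_k^c(t)$ with weights $m_k(b,\mathrm{loc}^b_k(t)),m_k(c,\mathrm{loc}^c_k(t))$. Assume the axiom system $\mathsf{SpecRelDyn}$: 1. ($\mathsf{AxSelf_0}$) for $m\in\mathrm{Ob}$: $m\in \mathrm{ev}_m(p)$ iff $\mathrm{ev}_m(p)\ne\emptyset$ and $p_\sigma=0$; 2. ($\mathsf{AxPh}$) for $m\in\mathrm{IOb}$: $|p_\sigma-q_\sigma|=|p_\tau-q_\tau|$ iff some photon is in $\mathrm{ev}_m(p)\cap\mathrm{ev}_m(q)$; 3. ($\mathsf{AxEv}$) $\mathrm{Ev}_m=\mathrm{Ev}_k$ for $m,k\in\mathrm{IOb}$; 4. ($\mathsf{AxSymDist}$) any $m,k\in\mathrm{IOb}$ agree on the spatial distance of two events in $\mathrm{Ev}_m\cap\mathrm{Ev}_k$ that are simultaneous for both; 5. ($\mathsf{AxMass}$)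 for $k\in\mathrm{Ob}$, $m_k(b,p)$ is defined and $\ge 0$, and it is $0$ iff $b\notin\mathrm{ev}_k(p)$; 6. ($\mathsf{AxCenter}$) for $k\in\mathrm{IOb}$ and inertial bodies $b,c,d$ with $\mathrm{inecoll}_k(b,c:d)$, $\mathrm{cen}_k(b,c)\cup\mathrm{wl}_k(d)$ is contained in a line; 7. ($\mathsf{AxSpeed}$) for $k\in\mathrm{IOb}$ and inertial bodies $b\in \mathrm{ev}_k(p)$, $c\in\mathrm{ev}_k(q)$: if $m_0(b)=m_0(c)$ and $v_k^b(p_\tau)=v_k^c(q_\tau)$, then $m_k(b,p)=m_k(c,q)$; 8. ($\mathsf{Ax\forall inecoll}$) for $k\in\mathrm{IOb}$, $\mathbf v_1\neq\mathbf v_2$ in $Q^{n}$ of length $<1$, and $m_1,m_2>0$ in $Q$, there are inertial bodies $b,c,d$ with $\mathrm{inecoll}_k(b,c:d)$, $\mathbf v_k(b)=\mathbf v_1$, $\mathbf v_k(c)=\mathbf v_2$, $m_0(b)=m_1$, $m_0(c)=m_2$; 9. ($\mathsf{AxThExp^\uparrow}$) for $k\in\mathrm{IOb}$ and $p,q$ with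 $|(p-q)_\sigma|<(p-q)_\tau$ there is $h\in\mathrm{IOb}$ with $h\in\mathrm{ev}_k(p)\cap\mathrm{ev}_k(q)$ and $w^k_h(q)_\tau<w^k_h(p)_\tau$. Assume moreover that no incoming or outgoing body is faster than light: if $k\in\mathrm{IOb}$, $b\in\mathrm{in}_k(q)\cup\mathrm{out}_k(q)$ and $p\in\mathrm{wl}_k(b)$, then $|p_\sigma-q_\sigma|\le|p_\tau-q_\tau|$. Then for every $k\in\mathrm{IOb}$ and every inertial body $b$ that has a rest mass and is slower than light according to $k$ (i.e. $|p_\sigma-q_\sigma|<|p_\tau-q_\tau|$ for distinct $p,q\in\mathrm{wl}_k(b)$), the quantities $v_k(b)$ and $m_k(b)$ are defined, $v_k(b)^2\le 1$, and $$m_0(b)=\sqrt{1-v_k(b)^2}\cdot m_k(b).$$ -/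

import Mathlib

universe u v

/-- An ordered field is Euclidean when positive elements have square roots. -/
def IsEuclideanField (Q : Type u) [Field Q] [LinearOrder Q] : Prop :=
  ∀ x : Q, 0 < x → ∃ y : Q, y * y = x

open Classical in
/-- The nonnegative square root; it is only meaningful where such a root exists. -/
noncomputable def eSqrt {Q : Type u} [Field Q] [LinearOrder Q] (x : Q) : Q :=
  if h : ∃ y : Q, 0 ≤ y ∧ y * y = x then h.choose else 0

/-- Euclidean length of an `n`-tuple of quantities. -/
noncomputable def eLen {Q : Type u} [Field Q] [LinearOrder Q] {n : ℕ} (p : Fin n → Q) : Q :=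
  eSqrt (∑ i, p i ^ 2)

/-- Coordinate points of a spacetime of dimension `d = n + 1`. -/
abbrev Coord (Q : Type u) (n : ℕ) : Type u := Fin (n + 1) → Q

/-- Time component. -/
def Coord.tm {Q : Type u} {n : ℕ} (p : Coord Q n) : Q := p 0

/-- Space component. -/
def Coord.sp {Q : Type u} {n : ℕ} (p : Coord Q n) : Fin n → Q := fun i => p i.succ

/-- The line through two coordinate points. -/
def lineThrough {Q : Type u} [Field Q] {n : ℕ} (p q : Coord Q n) : Set (Coord Q n) :=
  {r | ∃ c : Q, r = p + c • (p - q)}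

/-- `l` is a line. -/
def IsLine {Q : Type u} [Field Q] {n : ℕ} (l : Set (Coord Q n)) : Prop :=
  ∃ p q : Coord Q n, p ≠ q ∧ l = lineThrough p q

/-- `H` is a line segment: connected, contained in a line, with at least two elements. -/
def IsLineSegment {Q : Type u} [Field Q] [LinearOrder Q] {n : ℕ} (H : Set (Coord Q n)) : Prop :=
  (∀ p ∈ H, ∀ q ∈ H, ∀ c : Q, 0 ≤ c → c ≤ 1 → c • p + (1 - c) • q ∈ H) ∧
    (∃ l, IsLine l ∧ H ⊆ l) ∧ H.Nontrivial

/-- A structure for the language of dynamics, with sort `Q` of quantities, sort `B` of bodies, and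
spacetime dimension `n + 1`. `W m b p`: observer `m` coordinatizes body `b` at `p`.
`M b p x k`: the relativistic mass of `b` at `p` is `x` according to observer `k`. -/
structure DynModel (Q : Type u) (n : ℕ) (B : Type v) where
  Ob : Set B
  IOb : Set B
  Ph : Set B
  W : B → B → Coord Q n → Prop
  M : B → Coord Q n → Q → B → Prop
  iob_subset_ob : IOb ⊆ Ob
  ob_of_w : ∀ m b p, W m b p → m ∈ Ob

namespace DynModel

/-! ### Kinematics -/

section Kinematics

variable {Q : Type u} [Field Q] [LinearOrder Q] {n : ℕ} {B : Type v} (S : DynModel Q n B)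

/-- The event observed by `m` at `p`. -/
def ev (m : B) (p : Coord Q n) : Set B := {b | S.W m b p}

/-- The nonempty events coordinatized by `m`. -/
def Ev (m : B) : Set (Set B) := {e | e.Nonempty ∧ ∃ p, S.ev m p = e}

/-- The coordinate domain of `m`. -/
def Cd (m : B) : Set (Coord Q n) := {p | (S.ev m p).Nonempty}

/-- The world-line of `b` according to `m`. -/
def wl (m b : B) : Set (Coord Q n) := {p | S.W m b p}

/-- The worldview transformation between `k` and `m`, as a binary relation. -/
def Wvt (k m : B) (p q : Coord Q n) : Prop := S.ev k p = S.ev m q ∧ (S.ev k p).Nonempty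

/-- The worldview transformation between `k` and `m` has a unique value at `p`, namely `q`. -/
def WvtVal (k m : B) (p q : Coord Q n) : Prop := ∀ r, S.Wvt k m p r ↔ r = q

/-- Events `e₁` and `e₂` are simultaneous for `m`. -/
def Simult (m : B) (e₁ e₂ : Set B) : Prop :=
  ∃ p q : Coord Q n, S.ev m p = e₁ ∧ S.ev m q = e₂ ∧ p.tm = q.tm

/-- The event `e` is localized by `m`, at its unique location `p`. -/
def LocEv (m : B) (e : Set B) (p : Coord Q n) : Prop := ∀ q, S.ev m q = e ↔ q = p

/-- The spatial distance of `e₁` and `e₂` according to `m` is defined and equals `x`. -/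
def DistEv (m : B) (e₁ e₂ : Set B) (x : Q) : Prop :=
  ∃ p q : Coord Q n, S.LocEv m e₁ p ∧ S.LocEv m e₂ q ∧ x = eLen (p.sp - q.sp)

/-- An observer coordinatizes itself exactly at the points of its coordinate domain whose space
component is the origin. -/
def AxSelf₀ : Prop :=
  ∀ m ∈ S.Ob, ∀ p : Coord Q n, m ∈ S.ev m p ↔ p ∈ S.Cd m ∧ p.sp = 0

/-- For inertial observers, there is a photon through `p` and `q` iff the slope of `p - q` is 1. -/
def AxPh : Prop :=
  ∀ m ∈ S.IOb, ∀ p q : Coord Q n,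
    eLen (p.sp - q.sp) = |p.tm - q.tm| ↔ (S.Ph ∩ S.ev m p ∩ S.ev m q).Nonempty

/-- Inertial observers coordinatize the same events. -/
def AxEv : Prop := ∀ m ∈ S.IOb, ∀ k ∈ S.IOb, S.Ev m = S.Ev k

/-- Inertial observers agree on the spatial distance of events simultaneous for both of them. -/
def AxSymDist : Prop :=
  ∀ m ∈ S.IOb, ∀ k ∈ S.IOb, ∀ e₁ ∈ S.Ev m ∩ S.Ev k, ∀ e₂ ∈ S.Ev m ∩ S.Ev k,
    S.Simult m e₁ e₂ → S.Simult k e₁ e₂ → ∃ x, S.DistEv m e₁ e₂ x ∧ S.DistEv k e₁ e₂ x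

/-- The axiom system of special relativity. -/
def SpecRel : Prop := S.AxSelf₀ ∧ S.AxPh ∧ S.AxEv ∧ S.AxSymDist

/-- Inertial observers can send out forward inertial observers in any slower-than-light
direction. -/
def AxThExpUp : Prop :=
  ∀ k ∈ S.IOb, ∀ p q : Coord Q n, eLen (p - q).sp < (p - q).tm →
    ∃ h ∈ S.IOb, h ∈ S.ev k p ∩ S.ev k q ∧
      ∃ p' q' : Coord Q n, S.WvtVal k h p p' ∧ S.WvtVal k h q q' ∧ q'.tm < p'.tm

end Kinematics

/-! ### Dynamics -/

section Dynamics

variable {Q : Type u} [Field Q] [LinearOrder Q] {n : ℕ} {B : Type v} (S : DynModel Q n B)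

/-- The relativistic mass of `b` at `p` according to `k` is defined and equals `x`. -/
def MassAt (k b : B) (p : Coord Q n) (x : Q) : Prop :=
  S.M b p x k ∧ ∀ y, S.M b p y k → y = x

/-- Bodies whose world-lines end at `q` according to `k`. -/
def inc (k : B) (q : Coord Q n) : Set B :=
  {b | q ∈ S.wl k b ∧ ∀ p ∈ S.wl k b, p.tm < q.tm ∨ p = q}

/-- Bodies whose world-lines start at `q` according to `k`. -/
def out (k : B) (q : Coord Q n) : Set B :=
  {b | q ∈ S.wl k b ∧ ∀ p ∈ S.wl k b, p.tm > q.tm ∨ p = q}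

/-- Bodies `b` and `c` collide inelastically originating `d`, according to `k`. -/
def Inecoll (k b c d : B) : Prop :=
  b ≠ c ∧ ∃ q, S.inc k q = {b, c} ∧ S.out k q = {d}

/-- The spacetime location of `b` at instant `t` according to `k` is defined and equals `p`. -/
def LocAt (k b : B) (t : Q) (p : Coord Q n) : Prop :=
  ∀ r, (r ∈ S.wl k b ∧ r.tm = t) ↔ r = p

/-- The center of the masses of `b` and `c` at instant `t` according to `k` is defined and
equals `r`. -/
def CenAt (k b c : B) (t : Q) (r : Coord Q n) : Prop :=
  ∃ (p q : Coord Q n) (x y : Q), S.LocAt k b t p ∧ S.LocAt k c t q ∧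
    S.MassAt k b p x ∧ S.MassAt k c q y ∧ x + y ≠ 0 ∧ x • (r - p) + y • (r - q) = 0

/-- The center-line of the masses of `b` and `c` according to `k`. -/
def cen (k b c : B) : Set (Coord Q n) := {r | ∃ t, S.CenAt k b c t r}

/-- Inertial bodies. -/
def IB : Set B := {b | ∀ k ∈ S.IOb, IsLineSegment (S.wl k b)}

/-- `w` is a derivative at `t` of the spatial location of `b` according to `k`, as a partial
function of time. -/
def IsDerivAt (k b : B) (t : Q) (w : Fin n → Q) : Prop :=
  ∃ p : Coord Q n, S.LocAt k b t p ∧ ∀ ε : Q, 0 < ε → ∃ δ : Q, 0 < δ ∧ ∀ (s : Q) (r : Coord Q n),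
    S.LocAt k b s r → |s - t| < δ → eLen (r.sp - p.sp - (s - t) • w) ≤ ε * |s - t|

/-- The velocity of `b` at instant `t` according to `k` is defined and equals `w`. -/
def VelAt (k b : B) (t : Q) (w : Fin n → Q) : Prop :=
  S.IsDerivAt k b t w ∧ ∀ w', S.IsDerivAt k b t w' → w' = w

/-- The speed of `b` at instant `t` according to `k` is defined and equals `s`. -/
def SpeedAt (k b : B) (t : Q) (s : Q) : Prop := ∃ w, S.VelAt k b t w ∧ s = eLen w

/-- The constant velocity of `b` according to `k` is defined and equals `w`. -/
def Vel (k b : B) (w : Fin n → Q) : Prop :=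
  (∃ t, S.VelAt k b t w) ∧ ∀ t w', S.VelAt k b t w' → w' = w

/-- The speed of the constant velocity of `b` according to `k` is defined and equals `s`. -/
def Speed (k b : B) (s : Q) : Prop := ∃ w, S.Vel k b w ∧ s = eLen w

/-- `b` is at rest according to `k`: its speed is defined at some instant, and is zero whenever it
is defined. -/
def AtRest (k b : B) : Prop :=
  (∃ t s, S.SpeedAt k b t s) ∧ ∀ t s, S.SpeedAt k b t s → s = 0

/-- The rest mass of `b` is defined and equals `x`. -/
def RestMass (b : B) (x : Q) : Prop :=
  (∃ k ∈ S.Ob, S.AtRest k b ∧ ∀ p ∈ S.wl k b, S.MassAt k b p x) ∧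
    ∀ k ∈ S.Ob, S.AtRest k b → ∀ p ∈ S.wl k b, S.MassAt k b p x

/-- The constant relativistic mass of `b` according to `k` is defined and equals `x`. -/
def Mass (k b : B) (x : Q) : Prop :=
  (S.wl k b).Nonempty ∧ ∀ p ∈ S.wl k b, S.MassAt k b p x

/-- Relativistic mass is defined and nonnegative, and zero exactly where the body is absent. -/
def AxMass : Prop :=
  ∀ k ∈ S.Ob, ∀ (b : B) (p : Coord Q n),
    ∃ x, S.MassAt k b p x ∧ 0 ≤ x ∧ (x = 0 ↔ b ∉ S.ev k p)

/-- The world-line of the inertial body originated by an inelastic collision of two inertial bodies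
is the continuation of their center-line of masses. -/
def AxCenter : Prop :=
  ∀ k ∈ S.IOb, ∀ b ∈ S.IB, ∀ c ∈ S.IB, ∀ d ∈ S.IB, S.Inecoll k b c d →
    ∃ l, IsLine l ∧ S.cen k b c ∪ S.wl k d ⊆ l

/-- Relativistic masses of inertial bodies agree if their rest masses and speeds agree. -/
def AxSpeed : Prop :=
  ∀ k ∈ S.IOb, ∀ b ∈ S.IB, ∀ c ∈ S.IB, ∀ p q : Coord Q n,
    b ∈ S.ev k p → c ∈ S.ev k q →
    (∃ x, S.RestMass b x ∧ S.RestMass c x) →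
    (∃ s, S.SpeedAt k b p.tm s ∧ S.SpeedAt k c q.tm s) →
    ∃ x, S.MassAt k b p x ∧ S.MassAt k c q x

/-- For inertial observers, any possible kind of inelastic collision is realized. -/
def AxAllInecoll : Prop :=
  ∀ k ∈ S.IOb, ∀ (w₁ w₂ : Fin n → Q) (m₁ m₂ : Q),
    eLen w₁ < 1 → eLen w₂ < 1 → w₁ ≠ w₂ → 0 < m₁ → 0 < m₂ →
    ∃ b ∈ S.IB, ∃ c ∈ S.IB, ∃ d ∈ S.IB, S.Inecoll k b c d ∧
      S.Vel k b w₁ ∧ S.Vel k c w₂ ∧ S.RestMass b m₁ ∧ S.RestMass c m₂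

/-- The axiom system of special relativistic dynamics. -/
def SpecRelDyn : Prop :=
  S.AxMass ∧ S.AxCenter ∧ S.AxSpeed ∧ S.AxAllInecoll ∧ S.AxThExpUp ∧ S.SpecRel

/-- No incoming or outgoing body is faster than light: if the world-line of `b` ends or starts at
`q` according to an inertial observer, no point of it is spacelike-separated from `q`. -/
def NoFTLColliding : Prop :=
  ∀ k ∈ S.IOb, ∀ q : Coord Q n, ∀ b ∈ S.inc k q ∪ S.out k q, ∀ p ∈ S.wl k b,
    eLen (p.sp - q.sp) ≤ |p.tm - q.tm|

/-- `b` is slower than light according to `k`. -/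
def SlowerThanLight (k b : B) : Prop :=
  ∀ p ∈ S.wl k b, ∀ q ∈ S.wl k b, p ≠ q → eLen (p.sp - q.sp) < |p.tm - q.tm|

end Dynamics

end DynModel

/-! A worldview transformation between inertial observers is a bijection that preserves lightlike
separation in both directions. It is never shown to be linear; weaker incidence facts suffice.
`IsNullIso.map_parallelogram` preserves parallelograms with null sides,
`IsNullIso.map_timelike_line` sends timelike lines into lines, and `IsNullIso.map_same_side` says
that causal vectors at a point are not split between past and future.

The mass formula comes from one collision seen by two observers. Let `b` be at rest for `k` and let
`c` move with velocity `w = 2u/(1+|u|²)`, with equal rest masses. For a median observer `h` moving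
with velocity `u`, the two bodies are mirror images: points of their world-lines are opposite
vertices of a null parallelogram whose other diagonal lies on the world-line of `h`. So their speeds
agree for `h`, hence their masses do (`AxSpeed`), and `AxCenter` keeps the product `d` on the time
axis of `h`. Back in the frame of `k`, `d` has velocity `u`, and `AxCenter` for `k` gives `m/(m₀+m)
• w = u`, which determines `m`.

The collision must be the same collision for both observers. `AxThExpUp` makes `h` agree with `k` on
the direction of time along one timelike vector, and since colliding bodies are never faster than
light, causal order carries this agreement to all their points (`inc_out_eq`). Finally `AxSpeed`
transfers the mass of `c` to any inertial body with the same rest mass and speed. -/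

section Minkowski

variable {Q : Type u} [Field Q] {n : ℕ}

/-- The Minkowski product. -/
def mdot (x y : Coord Q n) : Q := x 0 * y 0 - ∑ i : Fin n, x i.succ * y i.succ

/-- The Minkowski square. -/
def msq (x : Coord Q n) : Q := mdot x x

theorem mdot_comm (x y : Coord Q n) : mdot x y = mdot y x := by
  simp only [mdot, mul_comm]

theorem mdot_add_left (x y z : Coord Q n) : mdot (x + y) z = mdot x z + mdot y z := by
  simp only [mdot, Pi.add_apply, add_mul, Finset.sum_add_distrib]; ring

theorem mdot_smul_left (c : Q) (x z : Coord Q n) : mdot (c • x) z = c * mdot x z := by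
  simp only [mdot, Pi.smul_apply, smul_eq_mul, mul_assoc, ← Finset.mul_sum]; ring

theorem mdot_add_right (x y z : Coord Q n) : mdot z (x + y) = mdot z x + mdot z y := by
  rw [mdot_comm, mdot_add_left, mdot_comm x, mdot_comm y]

theorem mdot_smul_right (c : Q) (x z : Coord Q n) : mdot z (c • x) = c * mdot z x := by
  rw [mdot_comm, mdot_smul_left, mdot_comm x]

theorem mdot_neg_left (x z : Coord Q n) : mdot (-x) z = -mdot x z := by
  rw [← neg_one_smul Q, mdot_smul_left]; ring

theorem mdot_neg_right (x z : Coord Q n) : mdot z (-x) = -mdot z x := by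
  rw [mdot_comm, mdot_neg_left, mdot_comm]

theorem mdot_sub_left (x y z : Coord Q n) : mdot (x - y) z = mdot x z - mdot y z := by
  rw [sub_eq_add_neg, mdot_add_left, mdot_neg_left, sub_eq_add_neg]

theorem mdot_sub_right (x y z : Coord Q n) : mdot z (x - y) = mdot z x - mdot z y := by
  rw [mdot_comm, mdot_sub_left, mdot_comm x, mdot_comm y]

theorem mdot_zero_left (x : Coord Q n) : mdot 0 x = 0 := by simp [mdot]

theorem msq_add (x y : Coord Q n) : msq (x + y) = msq x + 2 * mdot x y + msq y := by
  simp only [msq, mdot_add_left, mdot_add_right, mdot_comm y x]; ring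

theorem msq_sub (x y : Coord Q n) : msq (x - y) = msq x - 2 * mdot x y + msq y := by
  simp only [msq, mdot_sub_left, mdot_sub_right, mdot_comm y x]; ring

theorem msq_smul (c : Q) (x : Coord Q n) : msq (c • x) = c ^ 2 * msq x := by
  simp only [msq, mdot_smul_left, mdot_smul_right]; ring

theorem msq_neg (x : Coord Q n) : msq (-x) = msq x := by
  simp only [msq, mdot_neg_left, mdot_neg_right, neg_neg]

theorem msq_zero : msq (0 : Coord Q n) = 0 := by simp [msq, mdot]

theorem msq_sub_comm (x y : Coord Q n) : msq (x - y) = msq (y - x) := by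
  rw [← neg_sub, msq_neg]

theorem msq_eq (x : Coord Q n) : msq x = x 0 ^ 2 - ∑ i : Fin n, x i.succ ^ 2 := by
  simp only [msq, mdot, sq]

theorem mdot_self (x : Coord Q n) : mdot x x = msq x := rfl

theorem msq_sub_null {T e : Coord Q n} (he : msq e = 0) (h : 2 * mdot T e = msq T) :
    msq (T - e) = 0 := by
  rw [msq_sub, he, h]; ring

end Minkowski

/-! ### Causal vectors, time orientation, and a supply of null directions. -/

section Causality

variable {Q : Type u} [Field Q] [LinearOrder Q] [IsStrictOrderedRing Q] {n : ℕ}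

/-- A causal vector without time component is zero. -/
theorem eq_zero_of_causal {x : Coord Q n} (hx : 0 ≤ msq x) (h0 : x 0 = 0) : x = 0 := by
  have h : ∑ i : Fin n, x i.succ ^ 2 = 0 := by
    apply le_antisymm
    · rw [msq_eq, h0] at hx; linarith
    · exact Finset.sum_nonneg fun i _ => sq_nonneg _
  rw [Finset.sum_eq_zero_iff_of_nonneg fun i _ => sq_nonneg _] at h
  funext i
  refine Fin.cases h0 (fun j => ?_) i
  simpa using h j (Finset.mem_univ _)

/-- A causal vector orthogonal to a nonzero null vector is parallel to it. -/
theorem exists_smul_of_mdot_eq_zero {x e : Coord Q n} (hx : 0 ≤ msq x) (he : msq e = 0)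
    (he0 : e ≠ 0) (h : mdot x e = 0) : ∃ c : Q, x = c • e := by
  have he1 : e 0 ≠ 0 := fun h0 => he0 (eq_zero_of_causal he.ge h0)
  -- Subtracting the multiple of `e` that cancels the time component leaves the Minkowski square
  -- unchanged, so the remainder is causal with no time part.
  refine ⟨x 0 / e 0, sub_eq_zero.1 (eq_zero_of_causal ?_ ?_)⟩
  · rw [msq_sub, mdot_smul_right, h, msq_smul, he]; simpa using hx
  · simp [he1]

/-- Orthogonality would make the vector parallel to a null one, hence null. -/
theorem mdot_ne_zero_of_timelike {x e : Coord Q n} (hx : 0 < msq x) (he : msq e = 0)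
    (he0 : e ≠ 0) : mdot x e ≠ 0 := by
  intro h
  obtain ⟨c, rfl⟩ := exists_smul_of_mdot_eq_zero hx.le he he0 h
  rw [msq_smul, he] at hx; simp at hx

/-- The reversed Cauchy-Schwarz inequality, qualitatively. -/
theorem mdot_nonneg_of_causal {x y : Coord Q n} (hx : 0 ≤ msq x) (hy : 0 ≤ msq y)
    (h : 0 ≤ x 0 * y 0) : 0 ≤ mdot x y := by
  rw [msq_eq] at hx hy
  have hcs := Finset.sum_mul_sq_le_sq_mul_sq Finset.univ (fun i : Fin n => x i.succ)
    (fun i => y i.succ)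
  have h1 : (∑ i : Fin n, x i.succ ^ 2) * ∑ i : Fin n, y i.succ ^ 2 ≤ x 0 ^ 2 * y 0 ^ 2 :=
    mul_le_mul (by linarith) (by linarith) (Finset.sum_nonneg fun i _ => sq_nonneg _)
      (sq_nonneg _)
  have h2 : (∑ i : Fin n, x i.succ * y i.succ) ^ 2 ≤ (x 0 * y 0) ^ 2 := by
    rw [mul_pow]; exact hcs.trans h1
  have := abs_le_of_sq_le_sq' h2 h
  simp only [mdot]; linarith [this.2]

/-- Reads time orientation off a Minkowski square: otherwise the reversed Cauchy-Schwarz inequality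
for `-x` and `y` gives `mdot x y ≤ 0`, and then `x - y` is causal. -/
theorem mul_pos_of_spacelike_sub {x y : Coord Q n} (hx : 0 ≤ msq x) (hy : 0 ≤ msq y)
    (h : msq (x - y) < 0) : 0 < x 0 * y 0 := by
  by_contra hc
  have := mdot_nonneg_of_causal (x := -x) (by rwa [msq_neg]) hy
    (by simpa using hc)
  rw [mdot_neg_left] at this
  rw [msq_sub] at h; linarith

theorem mdot_mul_pos {x e : Coord Q n} (hx : 0 ≤ msq x) (he : msq e = 0) (he0 : e ≠ 0)
    (hxe : ∀ c : Q, x ≠ c • e) (h : 0 < x 0 * e 0) : 0 < mdot x e := by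
  refine lt_of_le_of_ne (mdot_nonneg_of_causal hx he.ge h.le) fun h' => ?_
  obtain ⟨c, hc⟩ := exists_smul_of_mdot_eq_zero hx he he0 h'.symm
  exact hxe c hc

/-- In at least two space dimensions there is a null direction avoiding two given ones. -/
theorem exists_null_not_parallel (hn : 2 ≤ n) {x y : Coord Q n} (hx : x ≠ 0) (hy : y ≠ 0) :
    ∃ e : Coord Q n, msq e = 0 ∧ e 0 = 1 ∧ (∀ c : Q, x ≠ c • e) ∧ ∀ c : Q, y ≠ c • e := by
  obtain ⟨m, rfl⟩ : ∃ m, n = m + 2 := ⟨n - 2, by omega⟩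
  -- Pigeonhole on the three pairwise non-parallel null directions given by `(1,0)`, `(-1,0)`,
  -- `(0,1)` on the unit circle: each of `x` and `y` is parallel to at most one of them.
  let e : Q → Q → Coord Q (m + 2) := fun α β => Fin.cons 1 (Fin.cons α (Fin.cons β 0))
  have he : ∀ α β : Q, α ^ 2 + β ^ 2 = 1 → msq (e α β) = 0 := by
    intro α β h
    simp only [msq_eq, e, Fin.sum_univ_succ, Fin.cons_zero, Fin.cons_succ]
    simp only [Pi.zero_apply, ne_eq, OfNat.ofNat_ne_zero, not_false_eq_true, zero_pow,
      Finset.sum_const_zero]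
    linear_combination -h
  have key : ∀ z : Coord Q (m + 2), z ≠ 0 → ∀ (α β α' β' c c' : Q), z = c • e α β →
      z = c' • e α' β' → α = α' ∧ β = β' := by
    intro z hz α β α' β' c c' h h'
    have h'' := h.symm.trans h'
    have h0 := congrFun h'' 0
    have h1 := congrFun h'' (Fin.succ 0)
    have h2 := congrFun h'' (Fin.succ (Fin.succ 0))
    simp only [e, Pi.smul_apply, Fin.cons_zero, Fin.cons_succ, smul_eq_mul, mul_one] at h0 h1 h2
    subst h0
    have hc : c ≠ 0 := by rintro rfl; exact hz (by simpa using h)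
    exact ⟨mul_left_cancel₀ hc h1, mul_left_cancel₀ hc h2⟩
  by_contra! hcon
  have H : ∀ α β : Q, α ^ 2 + β ^ 2 = 1 → (∃ c : Q, x = c • e α β) ∨ ∃ c : Q, y = c • e α β := by
    intro α β h
    by_cases hxe : ∃ c : Q, x = c • e α β
    · exact Or.inl hxe
    · push Not at hxe
      exact Or.inr (hcon _ (he α β h) rfl hxe)
  have N1 : ∀ z : Coord Q (m + 2), z ≠ 0 → (∃ c : Q, z = c • e 1 0) → (∃ c : Q, z = c • e (-1) 0) →
      False := by
    rintro z hz ⟨c, h⟩ ⟨c', h'⟩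
    have := (key z hz _ _ _ _ _ _ h h').1
    norm_num at this
  have N2 : ∀ α : Q, ∀ z : Coord Q (m + 2), z ≠ 0 → (∃ c : Q, z = c • e α 0) →
      (∃ c : Q, z = c • e 0 1) → False := by
    rintro α z hz ⟨c, h⟩ ⟨c', h'⟩
    have := (key z hz _ _ _ _ _ _ h h').2
    norm_num at this
  have A := H 1 0 (by norm_num)
  have B := H (-1) 0 (by norm_num)
  have C := H 0 1 (by norm_num)
  rcases A with A | A <;> rcases B with B | B
  · exact N1 x hx A B
  · exact C.elim (N2 1 x hx A) (N2 (-1) y hy B)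
  · exact C.elim (N2 (-1) x hx B) (N2 1 y hy A)
  · exact N1 y hy A B

/-- In at least two space dimensions every spacelike vector is orthogonal to a null vector. -/
theorem exists_null_orthogonal (hQ : IsEuclideanField Q) (hn : 2 ≤ n) {x : Coord Q n}
    (hx : msq x < 0) : ∃ e : Coord Q n, msq e = 0 ∧ e ≠ 0 ∧ mdot x e = 0 := by
  rw [msq_eq] at hx
  set S := ∑ i : Fin n, x i.succ ^ 2 with hS
  have hSpos : 0 < S := by nlinarith [sq_nonneg (x 0)]
  obtain ⟨i, hi⟩ : ∃ i : Fin n, x i.succ ≠ 0 := by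
    by_contra! h
    simp [hS, h] at hSpos
  obtain ⟨j, hj⟩ : ∃ j : Fin n, j ≠ i := by
    have : Nontrivial (Fin n) := Fin.nontrivial_iff_two_le.2 hn
    exact exists_ne i
  -- The projection of the space part of `x` to the `i`, `j` plane, turned by a right angle; it is
  -- orthogonal to the space part.
  let y : Fin n → Q := Pi.single i (-x j.succ) + Pi.single j (x i.succ)
  have hy1 : ∑ l, x l.succ * y l = 0 := by
    simp [y, mul_add, Finset.sum_add_distrib, Pi.single_apply]; ring
  have hyi : y i = -x j.succ := by simp [y, hj.symm]
  have hyj : y j = x i.succ := by simp [y, hj]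
  set T := ∑ l, y l ^ 2 with hT
  have hTpos : 0 < T :=
    Finset.sum_pos' (fun l _ => sq_nonneg _) ⟨j, Finset.mem_univ _, by rw [hyj]; positivity⟩
  -- The time part `S` and the term `x 0 * x l.succ` below secure orthogonality; `β` then makes the
  -- vector null. The radicand is positive because `x` is spacelike.
  obtain ⟨β, hβ⟩ := hQ ((S - x 0 ^ 2) * S / T) (by
    have : 0 < S - x 0 ^ 2 := by linarith
    positivity)
  have hβ' : β ^ 2 * T = (S - x 0 ^ 2) * S := by
    rw [sq, hβ]; field_simp
  refine ⟨Fin.cons S fun l => x 0 * x l.succ + β * y l, ?_, ?_, ?_⟩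
  · have : ∑ l, (x 0 * x l.succ + β * y l) ^ 2 = x 0 ^ 2 * S + β ^ 2 * T := by
      have : ∀ l, (x 0 * x l.succ + β * y l) ^ 2 =
        x 0 ^ 2 * x l.succ ^ 2 + 2 * x 0 * β * (x l.succ * y l) + β ^ 2 * y l ^ 2 := by
        intro l; ring
      simp only [this, Finset.sum_add_distrib, ← Finset.mul_sum, hy1, hS, hT]; ring
    simp only [msq_eq, Fin.cons_zero, Fin.cons_succ, this, hβ']; ring
  · intro h
    exact hSpos.ne' (by simpa using congrFun h 0)
  · have : ∑ l, x l.succ * (x 0 * x l.succ + β * y l) = x 0 * S := by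
      have : ∀ l, x l.succ * (x 0 * x l.succ + β * y l) =
        x 0 * x l.succ ^ 2 + β * (x l.succ * y l) := by
        intro l; ring
      simp only [this, Finset.sum_add_distrib, ← Finset.mul_sum, hy1, hS]; ring
    simp only [mdot, Fin.cons_zero, Fin.cons_succ, this]; ring

end Causality

/-! ### Bijections preserving lightlike separation. -/

section NullIso

variable {Q : Type u} [Field Q] {n : ℕ}

/-- A bijection of spacetime preserving lightlike separation in both directions. -/
def IsNullIso (f : Coord Q n ≃ Coord Q n) : Prop :=
  ∀ p q, msq (p - q) = 0 ↔ msq (f p - f q) = 0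

namespace IsNullIso

variable {f : Coord Q n ≃ Coord Q n}

theorem symm (hf : IsNullIso f) : IsNullIso f.symm := fun p q => by
  rw [hf (f.symm p)]; simp

theorem map_null (hf : IsNullIso f) (p : Coord Q n) {e : Coord Q n} (he : msq e = 0) :
    msq (f (p + e) - f p) = 0 := by
  rw [← hf]; simpa using he

theorem map_ne (p : Coord Q n) {e : Coord Q n} (he : e ≠ 0) : f (p + e) - f p ≠ 0 := by
  rw [sub_ne_zero]; simpa using he

variable [LinearOrder Q] [IsStrictOrderedRing Q]

/-- The three image points are pairwise lightlike separated. Two null vectors with null difference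
are orthogonal, hence parallel. -/
theorem map_null_line (hf : IsNullIso f) (p : Coord Q n) {e : Coord Q n} (he : msq e = 0)
    (he0 : e ≠ 0) (x : Q) : ∃ t : Q, f (p + x • e) = f p + t • (f (p + e) - f p) := by
  have h1 : msq (f (p + x • e) - f p) = 0 := hf.map_null p (by rw [msq_smul, he, mul_zero])
  have h2 : msq (f (p + x • e) - f (p + e)) = 0 := by
    rw [← hf, show p + x • e - (p + e) = (x - 1) • e by module, msq_smul, he, mul_zero]
  have h3 := hf.map_null p he
  rw [show f (p + x • e) - f (p + e) = (f (p + x • e) - f p) - (f (p + e) - f p) by abel,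
    msq_sub, h1, h3] at h2
  obtain ⟨t, ht⟩ := exists_smul_of_mdot_eq_zero h1.ge h3 (map_ne p he0) (by linarith)
  exact ⟨t, by rw [← ht]; abel⟩

/-- Null lines are covered in full, by applying `map_null_line` to the inverse. -/
theorem exists_map_eq (hf : IsNullIso f) (p : Coord Q n) {e : Coord Q n} (he : msq e = 0)
    (he0 : e ≠ 0) (t : Q) : ∃ x : Q, f (p + x • e) = f p + t • (f (p + e) - f p) := by
  obtain ⟨x, hx⟩ := hf.symm.map_null_line (f p) (hf.map_null p he) (map_ne p he0) t
  refine ⟨x, ?_⟩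
  rw [Equiv.symm_apply_eq] at hx
  simp only [add_sub_cancel, Equiv.symm_apply_apply, add_sub_cancel_left] at hx
  exact hx.symm

/-- Parallelograms with null sides are preserved. -/
theorem map_parallelogram (hf : IsNullIso f) (a : Coord Q n) {e₁ e₂ : Coord Q n}
    (h₁ : msq e₁ = 0) (h₂ : msq e₂ = 0) (h₁₂ : mdot e₁ e₂ ≠ 0) :
    f (a + e₁ + e₂) = f (a + e₁) + f (a + e₂) - f a := by
  have e10 : e₁ ≠ 0 := by rintro rfl; exact h₁₂ (mdot_zero_left _)
  set v := f (a + e₁) - f a with hv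
  set d := f (a + e₂) - f a with hd
  set v' := f (a + e₂ + e₁) - f (a + e₂) with hv'
  have v0 : msq v = 0 := hf.map_null a h₁
  have d0 : msq d = 0 := hf.map_null a h₂
  have v0' : msq v' = 0 := hf.map_null _ h₁
  have vne : v ≠ 0 := map_ne a e10
  have hdv : mdot d v ≠ 0 := by
    intro h
    have : msq (f (a + e₂) - f (a + e₁)) = 0 := by
      rw [show f (a + e₂) - f (a + e₁) = d - v by rw [hv, hd]; abel, msq_sub, d0, v0, h]; ring
    rw [← hf, add_sub_add_left_eq_sub, msq_sub, h₁, h₂, mdot_comm] at this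
    exact h₁₂ (by linarith)
  -- If not, some point of the second image line has a Minkowski square of separation from points of
  -- the first that is constant along it. It would be lightlike separated from all of them or none,
  -- but its preimage is so from `a + x • e₁` and not from `a + (x + 1) • e₁`.
  have hvv : mdot v' v = 0 := by
    by_contra hne
    set t := -(mdot d v) / mdot v' v with ht
    have ht' : t * mdot v' v = -mdot d v := by rw [ht]; field_simp
    have hconst : ∀ s : Q, msq (d + t • v' - s • v) = 2 * t * mdot d v' := by
      intro s
      rw [msq_sub, msq_add, msq_smul, msq_smul, mdot_smul_right, mdot_smul_right, mdot_add_left,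
        mdot_smul_left, ht', v0, v0', d0]
      ring
    obtain ⟨x, hx⟩ := hf.exists_map_eq (a + e₂) h₁ e10 t
    obtain ⟨s₀, hs₀⟩ := hf.map_null_line a h₁ e10 x
    obtain ⟨s₁, hs₁⟩ := hf.map_null_line a h₁ e10 (x + 1)
    have hrel : ∀ y s : Q, f (a + y • e₁) = f a + s • v →
        msq (f (a + e₂ + x • e₁) - f (a + y • e₁)) = 2 * t * mdot d v' := by
      intro y s h
      rw [hx, h, ← hconst s, ← hv']
      congr 1
      rw [hd]; abel
    have r0 : msq (f (a + e₂ + x • e₁) - f (a + x • e₁)) = 0 := by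
      rw [← hf]; rw [show a + e₂ + x • e₁ - (a + x • e₁) = e₂ by abel, h₂]
    have r1 : msq (f (a + e₂ + x • e₁) - f (a + (x + 1) • e₁)) = 0 := by
      rw [hrel _ _ hs₁, ← hrel _ _ hs₀, r0]
    rw [← hf, show a + e₂ + x • e₁ - (a + (x + 1) • e₁) = e₂ - e₁ by module, msq_sub, h₁, h₂,
      mdot_comm] at r1
    exact h₁₂ (by linarith)
  obtain ⟨c, hc⟩ := exists_smul_of_mdot_eq_zero v0'.ge v0 vne hvv
  have r : msq (f (a + e₂ + e₁) - f (a + e₁)) = 0 := by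
    rw [← hf]; rw [show a + e₂ + e₁ - (a + e₁) = e₂ by abel, h₂]
  rw [show f (a + e₂ + e₁) - f (a + e₁) = d + v' - v by rw [hv, hd, hv']; abel, hc,
    show d + c • v - v = d + (c - 1) • v by module, msq_add, mdot_smul_right, msq_smul, d0,
    v0] at r
  -- The image sides are parallel; the null fourth side fixes their ratio.
  have hc1 : c = 1 := by
    have : (c - 1) * mdot d v = 0 := by linarith
    rcases mul_eq_zero.1 this with h | h
    · linarith
    · exact absurd h hdv
  rw [hc1, one_smul, hv', hv] at hc
  rw [add_right_comm, ← sub_add_cancel (f (a + e₂ + e₁)) (f (a + e₂)), hc]; abel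

/-- Timelike lines are mapped to lines. -/
theorem map_timelike_line (hf : IsNullIso f) (hn : 2 ≤ n) (a : Coord Q n) {T : Coord Q n}
    (hT : 0 < msq T) (x : Q) : ∃ c : Q, f (a + x • T) = f a + c • (f (a + T) - f a) := by
  rcases eq_or_ne x 0 with rfl | hx
  · exact ⟨0, by simp⟩
  have T0 : T ≠ 0 := by rintro rfl; simp [msq_zero] at hT
  -- Every null direction can be scaled so that `T` minus it is null too; thus `T` is a sum of two
  -- null vectors in many ways.
  have scale : ∀ e : Coord Q n, msq e = 0 → e ≠ 0 → ∃ c : Q, c ≠ 0 ∧ msq (c • e) = 0 ∧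
      msq (T - c • e) = 0 ∧ 2 * mdot T (c • e) = msq T := by
    intro e he he0
    have h1 := mdot_ne_zero_of_timelike hT he he0
    have h2 : 2 * mdot T ((msq T / (2 * mdot T e)) • e) = msq T := by
      rw [mdot_smul_right]; field_simp
    have h3 : msq ((msq T / (2 * mdot T e)) • e) = 0 := by rw [msq_smul, he, mul_zero]
    refine ⟨msq T / (2 * mdot T e), ?_, h3, msq_sub_null h3 h2, h2⟩
    have := hT.ne'
    positivity
  obtain ⟨b, hb, hb0, -, -⟩ := exists_null_not_parallel hn T0 T0
  have hbne : b ≠ 0 := by rintro rfl; simp at hb0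
  obtain ⟨c₁, hc₁, n1, n2, m1⟩ := scale b hb hbne
  set e₁ := c₁ • b
  set e₂ := T - e₁ with he₂
  have mdot_pair : ∀ e : Coord Q n, msq e = 0 → 2 * mdot T e = msq T →
      2 * mdot e (T - e) = msq T := by
    intro e h h'
    rw [mdot_sub_right, mdot_self, h, mdot_comm, sub_zero, h']
  have m12 := mdot_pair e₁ n1 m1
  have e1ne : e₁ ≠ 0 := smul_ne_zero hc₁ hbne
  have e2ne : e₂ ≠ 0 := by
    intro h; rw [← he₂, h, mdot_comm, mdot_zero_left] at m12; linarith
  -- A second decomposition of `T`, distinct from the first even up to order.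
  obtain ⟨b', hb', hb0', hne1, hne2⟩ := exists_null_not_parallel hn e1ne e2ne
  have hbne' : b' ≠ 0 := by rintro rfl; simp at hb0'
  obtain ⟨c₃, hc₃, n3, n4, m3⟩ := scale b' hb' hbne'
  have ne13 : e₁ ≠ c₃ • b' := hne1 _
  have ne23 : e₂ ≠ c₃ • b' := hne2 _
  set e₃ := c₃ • b'
  set e₄ := T - e₃ with he₄
  have m34 := mdot_pair e₃ n3 m3
  have e3ne : e₃ ≠ 0 := smul_ne_zero hc₃ hbne'
  have e4ne : e₄ ≠ 0 := by
    intro h; rw [← he₄, h, mdot_comm, mdot_zero_left] at m34; linarith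
  have main : ∀ e e' : Coord Q n, msq e = 0 → msq e' = 0 → e ≠ 0 → e' ≠ 0 → e + e' = T →
      mdot e e' ≠ 0 → f (a + T) - f a = (f (a + e) - f a) + (f (a + e') - f a) ∧
      ∃ s t : Q, f (a + x • T) - f a = s • (f (a + e) - f a) + t • (f (a + e') - f a) := by
    intro e e' h h' h0 h0' hTe hm
    constructor
    · rw [← hTe, ← add_assoc, hf.map_parallelogram a h h' hm]; abel
    · obtain ⟨s, hs⟩ := hf.map_null_line a h h0 x
      obtain ⟨t, ht⟩ := hf.map_null_line a h' h0' x
      refine ⟨s, t, ?_⟩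
      rw [← hTe, smul_add, ← add_assoc, hf.map_parallelogram a (by rw [msq_smul, h, mul_zero])
        (by rw [msq_smul, h', mul_zero]) (by
          rw [mdot_smul_left, mdot_smul_right]
          exact mul_ne_zero hx (mul_ne_zero hx hm)), hs, ht]
      abel
  obtain ⟨s12, s, t, hst⟩ := main e₁ e₂ n1 n2 e1ne e2ne (by rw [he₂]; abel)
    (by intro h; rw [h] at m12; linarith)
  obtain ⟨s34, s', t', hst'⟩ := main e₃ e₄ n3 n4 e3ne e4ne (by rw [he₄]; abel)
    (by intro h; rw [h] at m34; linarith)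
  have N1 := hf.map_null a n1
  have N2 := hf.map_null a n2
  have N3 := hf.map_null a n3
  have N4 := hf.map_null a n4
  have hT' : msq (f (a + T) - f a) ≠ 0 := by
    rw [Ne, ← hf]; simpa using hT.ne'
  have i13 : f (a + e₁) - f a ≠ f (a + e₃) - f a := by simpa using ne13
  have i23 : f (a + e₂) - f a ≠ f (a + e₃) - f a := by simpa using ne23
  set E₁ := f (a + e₁) - f a
  set E₂ := f (a + e₂) - f a
  set E₃ := f (a + e₃) - f a
  set E₄ := f (a + e₄) - f a
  set T' := f (a + T) - f a
  -- Equal coefficients mean a multiple of `T'`. Otherwise compare the two decompositions: pairing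
  -- with `T'` equates the coefficient sums, so the differences `E₁ - E₂` and `E₃ - E₄` are
  -- proportional. Both have Minkowski square `-msq T'`, so they agree up to sign, and `E₃` is `E₁`
  -- or `E₂`.
  have hst0 : s = t := by
    by_contra hne
    have hE2 : E₂ = T' - E₁ := by rw [s12]; abel
    have hE4 : E₄ = T' - E₃ := by rw [s34]; abel
    have q1 : 2 * mdot T' E₁ = msq T' := by rw [hE2, msq_sub, N1] at N2; linarith
    have q3 : 2 * mdot T' E₃ = msq T' := by rw [hE4, msq_sub, N3] at N4; linarith
    have hsum : s • E₁ + t • E₂ = s' • E₃ + t' • E₄ := hst.symm.trans hst'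
    rw [hE2, hE4] at hsum
    have hin := congrArg (fun z => 2 * mdot T' z) hsum
    simp only [mdot_add_right, mdot_smul_right, mdot_sub_right, mdot_self] at hin
    have hsum' : s + t = s' + t' := by
      have : (s + t) * msq T' = (s' + t') * msq T' := by
        linear_combination hin + (t - s) * q1 + (s' - t') * q3
      exact mul_right_cancel₀ hT' this
    have hD : (s - t) • (E₁ - (T' - E₁)) = (s' - t') • (E₃ - (T' - E₃)) := by
      have h1 : (s - t) • (E₁ - (T' - E₁)) =
          (2 : Q) • (s • E₁ + t • (T' - E₁)) - (s + t) • T' := by module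
      have h2 : (s' - t') • (E₃ - (T' - E₃)) =
          (2 : Q) • (s' • E₃ + t' • (T' - E₃)) - (s' + t') • T' := by module
      rw [h1, h2, hsum, hsum']
    have hsq := congrArg msq hD
    simp only [msq_smul] at hsq
    have sqE : ∀ E : Coord Q n, msq E = 0 → 2 * mdot T' E = msq T' →
        msq (E - (T' - E)) = - msq T' := by
      intro E h h'
      rw [msq_sub, msq_sub, mdot_sub_right, mdot_comm E, mdot_self, h]; linear_combination (-2) * h'
    rw [sqE _ N1 q1, sqE _ N3 q3] at hsq
    have hsq' : (s - t) ^ 2 = (s' - t') ^ 2 := mul_right_cancel₀ (neg_ne_zero.2 hT') hsq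
    have hst1 : s - t ≠ 0 := sub_ne_zero.2 hne
    rcases sq_eq_sq_iff_eq_or_eq_neg.1 hsq' with h | h
    · rw [← h] at hD
      have hD' := smul_right_injective _ hst1 hD
      apply i13
      have : (2 : Q) • E₁ = (2 : Q) • E₃ := by
        rw [show (2 : Q) • E₁ = E₁ - (T' - E₁) + T' by module, hD']; module
      exact smul_right_injective _ two_ne_zero this
    · rw [show s' - t' = -(s - t) by linarith, neg_smul, ← smul_neg] at hD
      have hD' := smul_right_injective _ hst1 hD
      apply i23
      have : (2 : Q) • E₂ = (2 : Q) • E₃ := by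
        rw [hE2, show (2 : Q) • (T' - E₁) = T' - (E₁ - (T' - E₁)) by module, hD']; module
      exact smul_right_injective _ two_ne_zero this
  refine ⟨s, ?_⟩
  rw [s12, smul_add, ← sub_eq_iff_eq_add', hst, ← hst0]

/-- Timelike separation is preserved. -/
theorem map_timelike (hf : IsNullIso f) (hQ : IsEuclideanField Q) (hn : 2 ≤ n)
    {p q : Coord Q n} (h : 0 < msq (p - q)) : 0 < msq (f p - f q) := by
  by_contra hcon
  have hne : msq (f p - f q) ≠ 0 := by rw [Ne, ← hf]; exact h.ne'
  -- The null line through `f q` along `e` has no point lightlike separated from `f p`, whereas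
  -- every null line through `q` has a point lightlike separated from `p`.
  obtain ⟨e, he, he0, hpe⟩ := exists_null_orthogonal hQ hn (lt_of_le_of_ne (not_lt.1 hcon) hne)
  obtain ⟨z, hz⟩ : ∃ z, f (q + z) = f q + e := ⟨f.symm (f q + e) - q, by simp⟩
  have hz1 : f (q + z) - f q = e := by rw [hz]; abel
  have hz0 : z ≠ 0 := by
    rintro rfl; exact he0 (by rw [← hz1]; simp)
  have hzn : msq z = 0 := by
    have := (hf (q + z) q).2 (by rw [hz1, he])
    simpa using this
  have hm := mdot_ne_zero_of_timelike h hzn hz0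
  set s := msq (p - q) / (2 * mdot (p - q) z) with hs
  obtain ⟨t, ht⟩ := hf.map_null_line q hzn hz0 s
  have h1 : msq (p - (q + s • z)) = 0 := by
    rw [show p - (q + s • z) = (p - q) - s • z by abel, msq_sub, mdot_smul_right, msq_smul, hzn,
      hs]
    field_simp; ring
  rw [hf, ht, hz1, show f p - (f q + t • e) = (f p - f q) - t • e by abel, msq_sub,
    mdot_smul_right, msq_smul, he, hpe] at h1
  exact hne (by linarith)

theorem map_causal (hf : IsNullIso f) (hQ : IsEuclideanField Q) (hn : 2 ≤ n)
    {p q : Coord Q n} (h : 0 ≤ msq (p - q)) : 0 ≤ msq (f p - f q) := by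
  rcases h.lt_or_eq with h | h
  · exact (hf.map_timelike hQ hn h).le
  · exact ((hf p q).1 h.symm).ge

theorem map_spacelike (hf : IsNullIso f) (hQ : IsEuclideanField Q) (hn : 2 ≤ n)
    {p q : Coord Q n} (h : msq (p - q) < 0) : msq (f p - f q) < 0 := by
  by_contra hcon
  have := hf.symm.map_causal hQ hn (not_lt.1 hcon)
  simp only [Equiv.symm_apply_apply] at this
  linarith

/-- Causal vectors at a point that point to the same side in time keep doing so. -/
theorem map_same_side (hf : IsNullIso f) (hQ : IsEuclideanField Q) (hn : 2 ≤ n)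
    {p x y : Coord Q n} (hx : 0 ≤ msq (x - p)) (hy : 0 ≤ msq (y - p))
    (h : 0 < (x - p) 0 * (y - p) 0) : 0 < (f x - f p) 0 * (f y - f p) 0 := by
  have hx0 : x - p ≠ 0 := by intro h0; rw [h0] at h; simp at h
  have hy0 : y - p ≠ 0 := by intro h0; rw [h0] at h; simp at h
  -- Far enough along `e`, to the past or future as needed, a point is spacelike separated from both
  -- `x` and `y`. This persists under `f` and puts both images on the side of its image.
  obtain ⟨e, he, he1, hxe, hye⟩ := exists_null_not_parallel hn hx0 hy0
  have he0 : e ≠ 0 := by rintro rfl; simp at he1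
  obtain ⟨s, hs1, hs2⟩ : ∃ s : Q, msq (x - p) < 2 * s * mdot (x - p) e ∧
      msq (y - p) < 2 * s * mdot (y - p) e := by
    have bound : ∀ z : Coord Q n, 0 ≤ msq z → (∀ c : Q, z ≠ c • e) → 0 < z 0 →
        ∃ s₀ : Q, ∀ s, s₀ ≤ s → msq z < 2 * s * mdot z e := by
      intro z hz hze hz0
      have hpos := mdot_mul_pos hz he he0 hze (by rw [he1]; linarith)
      refine ⟨(msq z + 1) / (2 * mdot z e), fun s hs => ?_⟩
      rw [div_le_iff₀ (by positivity)] at hs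
      linarith
    have bound' : ∀ z : Coord Q n, 0 ≤ msq z → (∀ c : Q, z ≠ c • e) → z 0 < 0 →
        ∃ s₀ : Q, ∀ s, s₀ ≤ s → msq z < 2 * (-s) * mdot z e := by
      intro z hz hze hz0
      obtain ⟨s₀, h₀⟩ := bound (-z) (by rwa [msq_neg])
        (fun c hc => hze (-c) (by rw [neg_smul, ← hc, neg_neg])) (by simpa using hz0)
      refine ⟨s₀, fun s hs => ?_⟩
      have := h₀ s hs
      rw [msq_neg, mdot_neg_left] at this
      linarith
    rcases pos_and_pos_or_neg_and_neg_of_mul_pos h with ⟨h1, h2⟩ | ⟨h1, h2⟩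
    · obtain ⟨s₁, b1⟩ := bound _ hx hxe h1
      obtain ⟨s₂, b2⟩ := bound _ hy hye h2
      exact ⟨max s₁ s₂, b1 _ (le_max_left _ _), b2 _ (le_max_right _ _)⟩
    · obtain ⟨s₁, b1⟩ := bound' _ hx hxe h1
      obtain ⟨s₂, b2⟩ := bound' _ hy hye h2
      exact ⟨-max s₁ s₂, b1 _ (le_max_left _ _), b2 _ (le_max_right _ _)⟩
  have side : ∀ z : Coord Q n, 0 ≤ msq (z - p) → msq (z - p) < 2 * s * mdot (z - p) e →
      0 < (f z - f p) 0 * (f (p + s • e) - f p) 0 := by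
    intro z hz hzs
    apply mul_pos_of_spacelike_sub (hf.map_causal hQ hn hz)
    · exact (hf.map_null p (by rw [msq_smul, he, mul_zero])).ge
    · rw [sub_sub_sub_cancel_right]
      apply hf.map_spacelike hQ hn
      rw [show z - (p + s • e) = (z - p) - s • e by abel, msq_sub, mdot_smul_right, msq_smul, he]
      linarith
  have h1 := side x hx hs1
  have h2 := side y hy hs2
  have := mul_pos h1 h2
  have h3 : (f (p + s • e) - f p) 0 ≠ 0 := by intro h0; rw [h0, mul_zero] at h1; exact h1.false
  have h4 := pow_pos (abs_pos.2 h3) 2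
  rw [sq_abs] at h4
  refine pos_of_mul_pos_left (b := (f (p + s • e) - f p) 0 ^ 2) ?_ h4.le
  linarith

end IsNullIso

end NullIso

/-! ### Euclidean length and its translation into Minkowski squares. -/

section Length

variable {Q : Type u} [Field Q] [LinearOrder Q] {n : ℕ}

theorem eLen_neg (x : Fin n → Q) : eLen (-x) = eLen x := by
  simp only [eLen, Pi.neg_apply, neg_sq]

variable [IsStrictOrderedRing Q]

theorem eSqrt_eq {x y : Q} (hy : 0 ≤ y) (h : y * y = x) : eSqrt x = y := by
  have hex : ∃ y : Q, 0 ≤ y ∧ y * y = x := ⟨y, hy, h⟩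
  have hs := hex.choose_spec
  rw [eSqrt, dif_pos hex]
  exact (mul_self_inj hs.1 hy).1 (hs.2.trans h.symm)

theorem eSqrt_spec (hQ : IsEuclideanField Q) {x : Q} (hx : 0 ≤ x) :
    0 ≤ eSqrt x ∧ eSqrt x * eSqrt x = x := by
  have hex : ∃ y : Q, 0 ≤ y ∧ y * y = x := by
    rcases hx.eq_or_lt with rfl | hx
    · exact ⟨0, le_rfl, mul_zero 0⟩
    · obtain ⟨y, hy⟩ := hQ x hx
      exact ⟨|y|, abs_nonneg y, by rw [abs_mul_abs_self, hy]⟩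
  rw [eSqrt, dif_pos hex]
  exact hex.choose_spec

theorem eLen_nonneg (hQ : IsEuclideanField Q) (x : Fin n → Q) : 0 ≤ eLen x :=
  (eSqrt_spec hQ (Finset.sum_nonneg fun _ _ => sq_nonneg _)).1

theorem eLen_sq (hQ : IsEuclideanField Q) (x : Fin n → Q) : eLen x ^ 2 = ∑ i, x i ^ 2 := by
  rw [sq]
  exact (eSqrt_spec hQ (Finset.sum_nonneg fun _ _ => sq_nonneg _)).2

theorem eLen_eq {x : Fin n → Q} {y : Q} (hy : 0 ≤ y) (h : ∑ i, x i ^ 2 = y ^ 2) : eLen x = y :=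
  eSqrt_eq hy (by rw [h, sq])

theorem eLen_zero : eLen (0 : Fin n → Q) = 0 := eLen_eq le_rfl (by simp)

theorem eLen_smul (hQ : IsEuclideanField Q) (c : Q) (x : Fin n → Q) :
    eLen (c • x) = |c| * eLen x := by
  refine eLen_eq (mul_nonneg (abs_nonneg c) (eLen_nonneg hQ x)) ?_
  rw [mul_pow, sq_abs, eLen_sq hQ, Finset.mul_sum]
  simp only [Pi.smul_apply, smul_eq_mul, mul_pow]

theorem eq_zero_of_eLen_eq_zero (hQ : IsEuclideanField Q) {x : Fin n → Q} (h : eLen x = 0) :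
    x = 0 := by
  have h1 := eLen_sq hQ x
  rw [h, zero_pow two_ne_zero, eq_comm,
    Finset.sum_eq_zero_iff_of_nonneg fun i _ => sq_nonneg _] at h1
  funext i
  simpa using h1 i (Finset.mem_univ _)

theorem msq_sub_eq (hQ : IsEuclideanField Q) (p q : Coord Q n) :
    msq (p - q) = |p.tm - q.tm| ^ 2 - eLen (p.sp - q.sp) ^ 2 := by
  rw [msq_eq, eLen_sq hQ, sq_abs]; rfl

theorem eLen_eq_iff (hQ : IsEuclideanField Q) (p q : Coord Q n) :
    eLen (p.sp - q.sp) = |p.tm - q.tm| ↔ msq (p - q) = 0 := by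
  rw [msq_sub_eq hQ, sub_eq_zero, eq_comm, sq_eq_sq₀ (abs_nonneg _) (eLen_nonneg hQ _)]

theorem eLen_le_iff (hQ : IsEuclideanField Q) (p q : Coord Q n) :
    eLen (p.sp - q.sp) ≤ |p.tm - q.tm| ↔ 0 ≤ msq (p - q) := by
  rw [msq_sub_eq hQ, sub_nonneg, sq_le_sq₀ (eLen_nonneg hQ _) (abs_nonneg _)]

end Length

/-! ### Coordinates and lines. -/

section Points

variable {Q : Type u} {n : ℕ}

theorem Coord.ext {p q : Coord Q n} (ht : p.tm = q.tm) (hs : p.sp = q.sp) : p = q := by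
  funext i
  exact Fin.cases ht (fun j => congrFun hs j) i

/-- The point with the given time and space components. -/
def Coord.mk (t : Q) (x : Fin n → Q) : Coord Q n := Fin.cons t x

theorem Coord.tm_mk (t : Q) (x : Fin n → Q) : (Coord.mk t x).tm = t := rfl
theorem Coord.sp_mk (t : Q) (x : Fin n → Q) : (Coord.mk t x).sp = x := rfl

variable [Field Q]

theorem msq_mk (t : Q) (x : Fin n → Q) : msq (Coord.mk t x) = t ^ 2 - ∑ i, x i ^ 2 := by
  simp [msq_eq, Coord.mk]

theorem Coord.tm_add (p q : Coord Q n) : (p + q).tm = p.tm + q.tm := rfl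
theorem Coord.sp_add (p q : Coord Q n) : (p + q).sp = p.sp + q.sp := rfl
theorem Coord.tm_sub (p q : Coord Q n) : (p - q).tm = p.tm - q.tm := rfl
theorem Coord.sp_sub (p q : Coord Q n) : (p - q).sp = p.sp - q.sp := rfl
theorem Coord.tm_smul (c : Q) (p : Coord Q n) : (c • p).tm = c * p.tm := rfl
theorem Coord.sp_smul (c : Q) (p : Coord Q n) : (c • p).sp = c • p.sp := rfl

theorem IsLine.exists_eq_add_smul {l : Set (Coord Q n)} (hl : IsLine l) {p q r : Coord Q n}
    (hp : p ∈ l) (hq : q ∈ l) (hpq : p ≠ q) (hr : r ∈ l) : ∃ c : Q, r = p + c • (q - p) := by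
  obtain ⟨a, b, hab, rfl⟩ := hl
  obtain ⟨x, rfl⟩ := hp
  obtain ⟨y, rfl⟩ := hq
  obtain ⟨z, rfl⟩ := hr
  have hxy : y - x ≠ 0 := by
    intro h
    rw [sub_eq_zero] at h
    exact hpq (by rw [h])
  refine ⟨(z - x) / (y - x), ?_⟩
  rw [show a + y • (a - b) - (a + x • (a - b)) = (y - x) • (a - b) by module, smul_smul,
    div_mul_cancel₀ _ hxy]
  module

end Points

namespace DynModel

theorem mem_wl_map {Q : Type u} {n : ℕ} {B : Type v} {S : DynModel Q n B} {k h : B}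
    {f : Coord Q n ≃ Coord Q n} (hev : ∀ p, S.ev h (f p) = S.ev k p) (b : B)
    (p : Coord Q n) : f p ∈ S.wl h b ↔ p ∈ S.wl k b := by
  have := congrArg (b ∈ ·) (hev p)
  exact iff_of_eq this

variable {Q : Type u} [Field Q] [LinearOrder Q] {n : ℕ} {B : Type v} {S : DynModel Q n B}
  {k h b : B}

/-! ### Velocities of bodies whose world-lines are segments. -/

section Segments

variable {p q : Coord Q n} {w : Fin n → Q}

theorem sp_sub_sp_of_segment (hseg : IsLineSegment (S.wl k b)) (hp : p ∈ S.wl k b)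
    (hq : q ∈ S.wl k b) (hne : p.tm ≠ q.tm) (hw : p.sp - q.sp = (p.tm - q.tm) • w)
    {r s : Coord Q n} (hr : r ∈ S.wl k b) (hs : s ∈ S.wl k b) :
    s.sp - r.sp = (s.tm - r.tm) • w := by
  obtain ⟨l, hl, hsub⟩ := hseg.2.1
  have hpq : q ≠ p := by rintro rfl; exact hne rfl
  obtain ⟨x, rfl⟩ := hl.exists_eq_add_smul (hsub hq) (hsub hp) hpq (hsub hr)
  obtain ⟨y, rfl⟩ := hl.exists_eq_add_smul (hsub hq) (hsub hp) hpq (hsub hs)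
  simp only [Coord.sp_add, Coord.sp_smul, Coord.sp_sub, Coord.tm_add, Coord.tm_smul,
    Coord.tm_sub, hw]
  module

theorem locAt_of_segment (hseg : IsLineSegment (S.wl k b)) (hp : p ∈ S.wl k b)
    (hq : q ∈ S.wl k b) (hne : p.tm ≠ q.tm) {r : Coord Q n} (hr : r ∈ S.wl k b) :
    S.LocAt k b r.tm r := by
  have hw : p.sp - q.sp = (p.tm - q.tm) • ((p.tm - q.tm)⁻¹ • (p.sp - q.sp)) := by
    rw [smul_inv_smul₀ (sub_ne_zero.2 hne)]
  intro s
  refine ⟨fun ⟨hs, ht⟩ => Coord.ext ht ?_, by rintro rfl; exact ⟨hr, rfl⟩⟩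
  have := sp_sub_sp_of_segment hseg hp hq hne hw hr hs
  rwa [ht, sub_self, zero_smul, sub_eq_zero] at this

variable [IsStrictOrderedRing Q]

/-- A body whose world-line is a non-horizontal segment has constant velocity. -/
theorem velAt_iff_of_segment (hQ : IsEuclideanField Q) (hseg : IsLineSegment (S.wl k b))
    (hp : p ∈ S.wl k b) (hq : q ∈ S.wl k b) (hne : p.tm ≠ q.tm)
    (hw : p.sp - q.sp = (p.tm - q.tm) • w) (t : Q) (w' : Fin n → Q) :
    S.VelAt k b t w' ↔ w' = w ∧ ∃ r ∈ S.wl k b, r.tm = t := by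
  have haff : ∀ {r s : Coord Q n}, r ∈ S.wl k b → s ∈ S.wl k b →
      s.sp - r.sp = (s.tm - r.tm) • w := fun hr hs => sp_sub_sp_of_segment hseg hp hq hne hw hr hs
  have hder : ∀ r ∈ S.wl k b, S.IsDerivAt k b r.tm w := by
    intro r hr
    refine ⟨r, locAt_of_segment hseg hp hq hne hr, fun ε hε => ⟨1, one_pos, fun s z hz _ => ?_⟩⟩
    obtain ⟨hz1, rfl⟩ := (hz z).2 rfl
    rw [haff hr hz1, sub_self, eLen_zero]
    positivity
  have huniq : ∀ t w'', S.IsDerivAt k b t w'' → w'' = w ∧ ∃ r ∈ S.wl k b, r.tm = t := by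
    rintro t w'' ⟨r, hloc, hd⟩
    obtain ⟨hr, rfl⟩ := (hloc r).2 rfl
    refine ⟨?_, r, hr, rfl⟩
    by_contra hww
    have hL : 0 < eLen (w - w'') := by
      refine lt_of_le_of_ne (eLen_nonneg hQ _) fun h0 => hww ?_
      exact (sub_eq_zero.1 (eq_zero_of_eLen_eq_zero hQ h0.symm)).symm
    -- Half the discrepancy of the two candidate derivatives is contradicted by a point of the
    -- segment, pulled towards `r` by the factor `c` to be within `δ` in time.
    obtain ⟨δ, hδ, H⟩ := hd (eLen (w - w'') / 2) (by positivity)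
    obtain ⟨z, hz, hzr⟩ : ∃ z ∈ S.wl k b, z.tm ≠ r.tm := by
      by_cases h : p.tm = r.tm
      · exact ⟨q, hq, fun h' => hne (h.trans h'.symm)⟩
      · exact ⟨p, hp, h⟩
    have hzr' : 0 < |z.tm - r.tm| := abs_pos.2 (sub_ne_zero.2 hzr)
    set c := min 1 (δ / (2 * |z.tm - r.tm|)) with hc
    have hc0 : 0 < c := lt_min one_pos (by positivity)
    have hmem := hseg.1 z hz r hr c hc0.le (min_le_left _ _)
    have htm : (c • z + (1 - c) • r).tm - r.tm = c * (z.tm - r.tm) := by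
      simp only [Coord.tm_add, Coord.tm_smul]; ring
    have habs : |(c • z + (1 - c) • r).tm - r.tm| = c * |z.tm - r.tm| := by
      rw [htm, abs_mul, abs_of_pos hc0]
    have hlt : c * |z.tm - r.tm| < δ := by
      calc c * |z.tm - r.tm| ≤ δ / (2 * |z.tm - r.tm|) * |z.tm - r.tm| :=
            mul_le_mul_of_nonneg_right (min_le_right _ _) hzr'.le
        _ = δ / 2 := by field_simp
        _ < δ := half_lt_self hδ
    have := H _ _ (locAt_of_segment hseg hp hq hne hmem) (by rw [habs]; exact hlt)
    rw [haff hr hmem, ← smul_sub, eLen_smul hQ, habs] at this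
    have h2 := mul_pos (mul_pos hc0 hzr') hL
    linarith
  refine ⟨fun h => huniq _ _ h.1, ?_⟩
  rintro ⟨rfl, r, hr, rfl⟩
  exact ⟨hder r hr, fun w'' h => (huniq _ _ h).1⟩

theorem vel_eq_of_segment (hQ : IsEuclideanField Q) (hseg : IsLineSegment (S.wl k b))
    (hp : p ∈ S.wl k b) (hq : q ∈ S.wl k b) (hne : p.tm ≠ q.tm) (hv : S.Vel k b w) :
    p.sp - q.sp = (p.tm - q.tm) • w := by
  have hw : p.sp - q.sp = (p.tm - q.tm) • ((p.tm - q.tm)⁻¹ • (p.sp - q.sp)) := by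
    rw [smul_inv_smul₀ (sub_ne_zero.2 hne)]
  have h := (velAt_iff_of_segment hQ hseg hp hq hne hw p.tm _).2 ⟨rfl, p, hp, rfl⟩
  rwa [hv.2 _ _ h] at hw

end Segments

/-! ### Worldview transformations and the invariance of collisions. -/

section Worldview

variable [IsStrictOrderedRing Q]

theorem photon_iff (hQ : IsEuclideanField Q) (hPh : S.AxPh) (hk : k ∈ S.IOb) (p q : Coord Q n) :
    msq (p - q) = 0 ↔ (S.Ph ∩ S.ev k p ∩ S.ev k q).Nonempty := by
  rw [← hPh k hk, eLen_eq_iff hQ]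

theorem ev_nonempty (hQ : IsEuclideanField Q) (hPh : S.AxPh) (hk : k ∈ S.IOb) (p : Coord Q n) :
    (S.ev k p).Nonempty := by
  obtain ⟨x, hx⟩ := (photon_iff hQ hPh hk p p).1 (by rw [sub_self, msq_zero])
  exact ⟨x, hx.2⟩

/-- Points with the same event are lightlike separated from the same points, so from each other. If
they were distinct, a null step from one in a direction not parallel to their difference would reach
a point lightlike separated from only one of them. -/
theorem ev_injective (hQ : IsEuclideanField Q) (hn : 2 ≤ n) (hPh : S.AxPh) (hk : k ∈ S.IOb) :
    Function.Injective (S.ev k) := by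
  intro p q hpq
  have key : ∀ r, msq (p - r) = 0 ↔ msq (q - r) = 0 := by
    intro r; rw [photon_iff hQ hPh hk, photon_iff hQ hPh hk, hpq]
  by_contra hne
  have hne' : q - p ≠ 0 := sub_ne_zero.2 (Ne.symm hne)
  have h0 : msq (q - p) = 0 := (key p).1 (by rw [sub_self, msq_zero])
  obtain ⟨e, he, he1, hpe, -⟩ := exists_null_not_parallel hn hne' hne'
  have h1 := (key (p + e)).1 (by rw [sub_add_cancel_left, msq_neg, he])
  rw [← sub_sub, msq_sub, h0, he] at h1
  obtain ⟨c, hc⟩ := exists_smul_of_mdot_eq_zero h0.ge he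
    (by rintro rfl; simp at he1) (by linarith : mdot (q - p) e = 0)
  exact hpe c hc

/-- Worldview transformations between inertial observers are bijections preserving lightlike
separation. -/
theorem exists_nullIso (hQ : IsEuclideanField Q) (hn : 2 ≤ n) (hS : S.SpecRel)
    (hk : k ∈ S.IOb) (hh : h ∈ S.IOb) :
    ∃ f : Coord Q n ≃ Coord Q n, IsNullIso f ∧ ∀ p, S.ev h (f p) = S.ev k p := by
  obtain ⟨-, hPh, hEv, -⟩ := hS
  have ex : ∀ k ∈ S.IOb, ∀ h ∈ S.IOb, ∀ p, ∃ q, S.ev h q = S.ev k p := by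
    intro k hk h hh p
    have : S.ev k p ∈ S.Ev h := by
      rw [hEv h hh k hk]; exact ⟨ev_nonempty hQ hPh hk p, p, rfl⟩
    exact this.2
  choose f hf using ex k hk h hh
  have hbij : Function.Bijective f := by
    constructor
    · intro p q hpq
      apply ev_injective hQ hn hPh hk
      rw [← hf, ← hf, hpq]
    · intro q
      obtain ⟨p, hp⟩ := ex h hh k hk q
      exact ⟨p, ev_injective hQ hn hPh hh (by rw [hf, hp])⟩
  refine ⟨Equiv.ofBijective f hbij, fun p q => ?_, hf⟩
  rw [photon_iff hQ hPh hk, photon_iff hQ hPh hh]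
  simp only [Equiv.ofBijective_apply, hf]

variable {f : Coord Q n ≃ Coord Q n} {a q : Coord Q n}

/-- The point `a`, in the causal past of `q` for both observers, calibrates the direction of time.
Points of colliding bodies are causally related to `q`, so being on the side of `a` transfers. -/
theorem inc_out_subset (hQ : IsEuclideanField Q) (hn : 2 ≤ n) (hN : S.NoFTLColliding)
    (hk : k ∈ S.IOb) (hf : IsNullIso f) (hev : ∀ p, S.ev h (f p) = S.ev k p)
    (haq : 0 ≤ msq (a - q)) (ht : a.tm < q.tm) (ht' : (f a).tm < (f q).tm) :
    S.inc k q ⊆ S.inc h (f q) ∧ S.out k q ⊆ S.out h (f q) := by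
  have haq' := hf.map_causal hQ hn haq
  have ht0 : (a - q) 0 < 0 := sub_neg.2 ht
  have ht0' : (f a - f q) 0 < 0 := sub_neg.2 ht'
  constructor
  · rintro x ⟨hx, hxp⟩
    refine ⟨(mem_wl_map hev x q).2 hx, fun p' hp' => ?_⟩
    obtain ⟨p, rfl⟩ := f.surjective p'
    rw [mem_wl_map hev] at hp'
    rcases hxp p hp' with h1 | rfl
    · left
      have hc := (eLen_le_iff hQ p q).1 (hN k hk q x (Or.inl ⟨hx, hxp⟩) p hp')
      have := hf.map_same_side hQ hn hc haq (mul_pos_of_neg_of_neg (sub_neg.2 h1) ht0)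
      exact sub_neg.1 (neg_of_mul_pos_left this ht0'.le)
    · exact Or.inr rfl
  · rintro x ⟨hx, hxp⟩
    refine ⟨(mem_wl_map hev x q).2 hx, fun p' hp' => ?_⟩
    obtain ⟨p, rfl⟩ := f.surjective p'
    rw [mem_wl_map hev] at hp'
    rcases hxp p hp' with h1 | rfl
    · left
      have hc := (eLen_le_iff hQ p q).1 (hN k hk q x (Or.inr ⟨hx, hxp⟩) p hp')
      have hc' := hf.map_causal hQ hn hc
      -- An image before `f q` would pull back under the inverse to the side of `a`; a simultaneous
      -- one would coincide with `f q`.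
      by_contra hcon
      rcases (not_lt.1 hcon).lt_or_eq with h2 | h2
      · have := hf.symm.map_same_side hQ hn hc' haq' (mul_pos_of_neg_of_neg (sub_neg.2 h2) ht0')
        simp only [Equiv.symm_apply_apply] at this
        have h3 : p.tm - q.tm < 0 := neg_of_mul_pos_left this ht0.le
        linarith
      · have h3 := eq_zero_of_causal hc' (sub_eq_zero.2 h2)
        have h4 : p = q := f.injective (sub_eq_zero.1 h3)
        rw [h4] at h1
        exact lt_irrefl _ h1
    · exact Or.inr rfl

/-- Inertial observers agreeing on the direction of time see the same bodies come in and go out. -/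
theorem inc_out_eq (hQ : IsEuclideanField Q) (hn : 2 ≤ n) (hN : S.NoFTLColliding)
    (hk : k ∈ S.IOb) (hh : h ∈ S.IOb) (hf : IsNullIso f)
    (hev : ∀ p, S.ev h (f p) = S.ev k p)
    (haq : 0 ≤ msq (a - q)) (ht : a.tm < q.tm) (ht' : (f a).tm < (f q).tm) :
    S.inc h (f q) = S.inc k q ∧ S.out h (f q) = S.out k q := by
  have h1 := inc_out_subset hQ hn hN hk hf hev haq ht ht'
  have h2 := inc_out_subset (f := f.symm) (a := f a) (q := f q) hQ hn hN hh hf.symm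
    (fun p => by rw [← hev, Equiv.apply_symm_apply]) (hf.map_causal hQ hn haq) ht' (by simpa)
  simp only [Equiv.symm_apply_apply] at h2
  exact ⟨h2.1.antisymm h1.1, h2.2.antisymm h1.2⟩

end Worldview

end DynModel

/-- A vector with vanishing space part is a multiple of any other with nonzero time part. -/
theorem Coord.eq_smul_of_sp_eq_zero {Q : Type u} [Field Q] {n : ℕ} {x y : Coord Q n}
    (hx : x.sp = 0) (hy : y.sp = 0) (h0 : y.tm ≠ 0) : x = (x.tm / y.tm) • y := by
  apply Coord.ext
  · rw [Coord.tm_smul, div_mul_cancel₀ _ h0]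
  · rw [Coord.sp_smul, hx, hy, smul_zero]

/-! ### Collisions and the mass of a moving body. -/

namespace DynModel

variable {Q : Type u} [Field Q] [LinearOrder Q] {n : ℕ} {B : Type v}
  {S : DynModel Q n B} {k h b : B} {q : Coord Q n} {w : Fin n → Q}

theorem exists_mem_tm_lt (hseg : IsLineSegment (S.wl k b)) (hb : b ∈ S.inc k q) :
    ∃ p ∈ S.wl k b, p.tm < q.tm := by
  obtain ⟨p, hp, hne⟩ := hseg.2.2.exists_ne q
  exact ⟨p, hp, (hb.2 p hp).resolve_right hne⟩

theorem exists_mem_lt_tm (hseg : IsLineSegment (S.wl k b)) (hb : b ∈ S.out k q) :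
    ∃ p ∈ S.wl k b, q.tm < p.tm := by
  obtain ⟨p, hp, hne⟩ := hseg.2.2.exists_ne q
  exact ⟨p, hp, (hb.2 p hp).resolve_right hne⟩

theorem massAt_pos (hM : S.AxMass) (hk : k ∈ S.Ob) {p : Coord Q n} (hp : p ∈ S.wl k b) {x : Q}
    (hx : S.MassAt k b p x) : 0 < x := by
  obtain ⟨y, hy, hy0, hyz⟩ := hM k hk b p
  obtain rfl := hx.2 y hy.1
  exact lt_of_le_of_ne hy0 fun h0 => hyz.1 h0.symm hp

/-- An observer for which the body is at rest must locate it somewhere, and mass is positive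
wherever the body is present. -/
theorem restMass_pos (hM : S.AxMass) {x : Q} (hb : S.RestMass b x) : 0 < x := by
  obtain ⟨⟨k, hk, ⟨⟨t, s, w, hw, -⟩, -⟩, hm⟩, -⟩ := hb
  obtain ⟨p, hloc, -⟩ := hw.1
  have hp := ((hloc p).2 rfl).1
  exact massAt_pos hM hk hp (hm p hp)

variable [IsStrictOrderedRing Q]

/-- The world-line of an incoming inertial body of velocity `w` contains an initial piece of the
backward ray of velocity `w`. -/
theorem exists_backward_ray (hQ : IsEuclideanField Q) (hseg : IsLineSegment (S.wl k b))
    (hb : b ∈ S.inc k q) (hv : S.Vel k b w) :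
    ∃ σ : Q, 0 < σ ∧ ∀ τ : Q, 0 ≤ τ → τ ≤ σ → q - τ • Coord.mk 1 w ∈ S.wl k b := by
  obtain ⟨p, hp, hlt⟩ := exists_mem_tm_lt hseg hb
  have hw := vel_eq_of_segment hQ hseg hp hb.1 hlt.ne hv
  have hσ : 0 < q.tm - p.tm := sub_pos.2 hlt
  refine ⟨q.tm - p.tm, hσ, fun τ h0 h1 => ?_⟩
  have hmem := hseg.1 p hp q hb.1 (τ / (q.tm - p.tm)) (by positivity)
    ((div_le_one hσ).2 h1)
  have hpe : p = q - (q.tm - p.tm) • Coord.mk 1 w := by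
    apply Coord.ext
    · simp only [Coord.tm_sub, Coord.tm_smul, Coord.tm_mk]; ring
    · rw [sub_eq_iff_eq_add.1 hw]
      simp only [Coord.sp_sub, Coord.sp_smul, Coord.sp_mk]
      module
  have key : ∀ D : Q, D ≠ 0 → p = q - D • Coord.mk 1 w →
      (τ / D) • p + (1 - τ / D) • q = q - τ • Coord.mk 1 w := by
    rintro D hD rfl
    rw [show ∀ v : Coord Q n, (τ / D) • (q - D • v) + (1 - τ / D) • q = q - (τ / D * D) • v by
      intro v; module, div_mul_cancel₀ _ hD]
  rwa [key _ hσ.ne' hpe] at hmem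

theorem atRest_of_vel_zero (hv : S.Vel k b 0) : S.AtRest k b := by
  obtain ⟨⟨t, ht⟩, hall⟩ := hv
  refine ⟨⟨t, _, 0, ht, rfl⟩, ?_⟩
  rintro t _ ⟨w, hw, rfl⟩
  rw [hall t w hw, eLen_zero]

/-- The opposite vertices of a null parallelogram with a diagonal on the time axis are mirror
images of each other with respect to the time axis. -/
theorem _root_.IsNullIso.map_parallelogram_time_axis {f : Coord Q n ≃ Coord Q n}
    (hf : IsNullIso f) {a e₁ e₂ : Coord Q n} (h₁ : msq e₁ = 0) (h₂ : msq e₂ = 0)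
    (h₁₂ : mdot e₁ e₂ ≠ 0) (ha : (f a).sp = 0) (ha' : (f (a + e₁ + e₂)).sp = 0) :
    (f (a + e₁)).tm = (f (a + e₂)).tm ∧ (f (a + e₂)).sp = -(f (a + e₁)).sp := by
  have hp := hf.map_parallelogram a h₁ h₂ h₁₂
  have hsp := congrArg Coord.sp hp
  have htm := congrArg Coord.tm hp
  simp only [Coord.sp_add, Coord.sp_sub, ha, ha', Coord.tm_add, Coord.tm_sub] at hsp htm
  have n1 : msq (f (a + e₁) - f a) = 0 := hf.map_null a h₁
  have n2 : msq (f (a + e₁ + e₂) - f (a + e₁)) = 0 := hf.map_null _ h₂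
  have hne : (f (a + e₁ + e₂)).tm - (f a).tm ≠ 0 := by
    intro h0
    have : f (a + e₁ + e₂) = f a := Coord.ext (sub_eq_zero.1 h0) (ha'.trans ha.symm)
    have := f.injective this
    rw [add_assoc, add_eq_left, add_eq_zero_iff_eq_neg] at this
    rw [this, mdot_neg_left, mdot_self, h₂, neg_zero] at h₁₂
    exact h₁₂ rfl
  have sq1 : ∀ x y : Coord Q n, x.sp = 0 →
      msq (y - x) = (y.tm - x.tm) ^ 2 - ∑ i, y.sp i ^ 2 := by
    intro x y hx
    have hx' : ∀ i : Fin n, x i.succ = 0 := fun i => congrFun hx i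
    rw [msq_eq]
    simp only [Pi.sub_apply, hx', sub_zero]
    rfl
  rw [sq1 _ _ ha] at n1
  rw [msq_sub_comm, sq1 _ _ ha'] at n2
  constructor
  · have : ((f (a + e₁ + e₂)).tm - (f a).tm) *
        (2 * (f (a + e₁)).tm - (f (a + e₁ + e₂)).tm - (f a).tm) = 0 := by
      linear_combination n1 - n2
    have := (mul_eq_zero.1 this).resolve_left hne
    linarith
  · rw [sub_zero, eq_comm, add_comm] at hsp
    exact eq_neg_of_add_eq_zero_left hsp

/-- There is a median observer: one that moves with velocity `u` through `q`. -/
theorem exists_median_observer (hQ : IsEuclideanField Q) (hn : 2 ≤ n) (hR : S.SpecRel)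
    (hT : S.AxThExpUp) (hk : k ∈ S.IOb) (q : Coord Q n) {u : Fin n → Q}
    (hu : ∑ i, u i ^ 2 < 1) :
    ∃ h ∈ S.IOb, ∃ f : Coord Q n ≃ Coord Q n, IsNullIso f ∧ (∀ p, S.ev h (f p) = S.ev k p) ∧
      (f (q - Coord.mk 1 u)).tm < (f q).tm ∧
      ∀ z, (f z).sp = 0 ↔ ∃ x : Q, z = q - x • Coord.mk 1 u := by
  have hlen : eLen u < 1 := by
    rw [← abs_of_nonneg (eLen_nonneg hQ u), ← sq_lt_one_iff_abs_lt_one, eLen_sq hQ]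
    exact hu
  obtain ⟨h, hh, ⟨h1, h2⟩, p', q', hp', hq', ht⟩ := hT k hk q (q - Coord.mk 1 u)
    (by simpa only [sub_sub_cancel, Coord.sp_mk, Coord.tm_mk] using hlen)
  obtain ⟨f, hf, hev⟩ := exists_nullIso hQ hn hR hk hh
  have hval : ∀ x y, S.WvtVal k h x y → y = f x := fun x y hxy =>
    ((hxy (f x)).1 ⟨(hev x).symm, ev_nonempty hQ hR.2.1 hk x⟩).symm
  obtain rfl := hval _ _ hp'
  obtain rfl := hval _ _ hq'
  have hself : ∀ x, h ∈ S.ev k x → (f x).sp = 0 := fun x hx =>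
    ((hR.1 h (S.iob_subset_ob hh) (f x)).1 (by rwa [hev])).2
  have s1 := hself _ h1
  have s2 := hself _ h2
  have hTl : 0 < msq (-Coord.mk 1 u) := by rw [msq_neg, msq_mk]; linarith
  refine ⟨h, hh, f, hf, hev, ht, fun z => ⟨fun hz => ?_, ?_⟩⟩
  · have hTl' : 0 < msq (f (q - Coord.mk 1 u) - f q) :=
      hf.map_timelike hQ hn (by rwa [sub_sub_cancel_left])
    have hne : (f (q - Coord.mk 1 u) - f q).tm ≠ 0 := by
      rw [Coord.tm_sub]; exact sub_ne_zero.2 ht.ne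
    have hz' := Coord.eq_smul_of_sp_eq_zero (x := f z - f q) (y := f (q - Coord.mk 1 u) - f q)
      (by rw [Coord.sp_sub, hz, s1, sub_zero]) (by rw [Coord.sp_sub, s2, s1, sub_zero]) hne
    -- The inverse sends the time axis of `h` back into a line, which yields the converse inclusion.
    obtain ⟨c, hc⟩ := hf.symm.map_timelike_line hn (f q) hTl'
      ((f z - f q).tm / (f (q - Coord.mk 1 u) - f q).tm)
    rw [← hz'] at hc
    simp only [add_sub_cancel, Equiv.symm_apply_apply, sub_sub_cancel_left] at hc
    exact ⟨c, by rw [hc]; module⟩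
  · rintro ⟨x, rfl⟩
    obtain ⟨c, hc⟩ := hf.map_timelike_line hn q hTl x
    rw [smul_neg, ← sub_eq_add_neg, ← sub_eq_add_neg] at hc
    rw [hc]
    simp only [Coord.sp_add, Coord.sp_smul, Coord.sp_sub, s1, s2]
    simp

/-- In an inelastic collision of incoming inertial bodies with equal rest masses moving
symmetrically with respect to the time axis, the originated body stays on the time axis. -/
theorem sp_eq_zero_of_symmetric_collision (hQ : IsEuclideanField Q) (hM : S.AxMass)
    (hC : S.AxCenter) (hSp : S.AxSpeed) (hh : h ∈ S.IOb) {b c d : B} (hb : b ∈ S.IB)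
    (hc : c ∈ S.IB) (hd : d ∈ S.IB) (hbc : b ≠ c) {q : Coord Q n} (hin : S.inc h q = {b, c})
    (hout : S.out h q = {d}) (hrest : ∃ x, S.RestMass b x ∧ S.RestMass c x) (hq : q.sp = 0)
    {P₁ P₂ : Coord Q n} (h₁ : P₁ ∈ S.wl h b) (h₂ : P₂ ∈ S.wl h c) (htq : P₁.tm ≠ q.tm)
    (ht : P₁.tm = P₂.tm) (hs : P₂.sp = -P₁.sp) {r : Coord Q n} (hr : r ∈ S.wl h d) :
    r.sp = 0 := by
  have hbq : q ∈ S.wl h b := by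
    have : b ∈ S.inc h q := by rw [hin]; simp
    exact this.1
  have hcq : q ∈ S.wl h c := by
    have : c ∈ S.inc h q := by rw [hin]; simp
    exact this.1
  have hdq : q ∈ S.wl h d := by
    have : d ∈ S.out h q := by rw [hout]; simp
    exact this.1
  have htq2 : P₂.tm ≠ q.tm := ht ▸ htq
  have hsub : P₁.tm - q.tm ≠ 0 := sub_ne_zero.2 htq
  set w := (P₁.tm - q.tm)⁻¹ • P₁.sp with hw
  have hw1 : P₁.sp - q.sp = (P₁.tm - q.tm) • w := by
    rw [hw, smul_inv_smul₀ hsub, hq, sub_zero]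
  have hw2 : P₂.sp - q.sp = (P₂.tm - q.tm) • (-w) := by
    rw [← ht, hw, smul_neg, smul_inv_smul₀ hsub, hq, sub_zero, hs]
  have v1 := (velAt_iff_of_segment hQ (hb h hh) h₁ hbq htq hw1 P₁.tm w).2 ⟨rfl, P₁, h₁, rfl⟩
  have v2 := (velAt_iff_of_segment hQ (hc h hh) h₂ hcq htq2 hw2 P₂.tm (-w)).2 ⟨rfl, P₂, h₂, rfl⟩
  obtain ⟨x, hx1, hx2⟩ := hSp h hh b hb c hc P₁ P₂ h₁ h₂ hrest
    ⟨eLen w, ⟨w, v1, rfl⟩, ⟨-w, v2, (eLen_neg w).symm⟩⟩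
  have hx0 := massAt_pos hM (S.iob_subset_ob hh) h₁ hx1
  obtain ⟨l, hl, hsubset⟩ := hC h hh b hb c hc d hd ⟨hbc, q, hin, hout⟩
  have hcen : (Coord.mk P₁.tm 0 : Coord Q n) ∈ S.cen h b c := by
    refine ⟨P₁.tm, P₁, P₂, x, x, locAt_of_segment (hb h hh) h₁ hbq htq h₁,
      ht ▸ locAt_of_segment (hc h hh) h₂ hcq htq2 h₂, hx1, hx2, by positivity, ?_⟩
    rw [← smul_add]
    convert smul_zero x
    apply Coord.ext
    · simp only [Coord.tm_add, Coord.tm_sub, Coord.tm_mk, ← ht]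
      change _ = (0 : Q)
      ring
    · simp only [Coord.sp_add, Coord.sp_sub, Coord.sp_mk, hs]
      change _ = (0 : Fin n → Q)
      abel
  -- Equal masses put the center at the midpoint, on the axis; together with `q` it spans the time
  -- axis.
  obtain ⟨y, rfl⟩ := hl.exists_eq_add_smul (hsubset (Or.inr hdq)) (hsubset (Or.inl hcen))
    (fun h0 => htq (congrArg Coord.tm h0).symm) (hsubset (Or.inr hr))
  simp [Coord.sp_add, Coord.sp_smul, Coord.sp_sub, Coord.sp_mk, hq]

/-- The relativistic mass of a moving body, in terms of the velocity `u` of the median observer. -/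
theorem exists_moving_mass (hQ : IsEuclideanField Q) (hn : 2 ≤ n) (hS : S.SpecRelDyn)
    (hN : S.NoFTLColliding) (hk : k ∈ S.IOb) {m₀ : Q} (hm₀ : 0 < m₀) {u : Fin n → Q} {ν : Q}
    (hν0 : 0 < ν) (hν1 : ν < 1) (hu : ∑ i, u i ^ 2 = ν ^ 2) :
    ∃ c ∈ S.IB, S.RestMass c m₀ ∧ ∃ p ∈ S.wl k c,
      S.VelAt k c p.tm ((2 / (1 + ν ^ 2)) • u) ∧
      ∃ m, S.MassAt k c p m ∧ m * (1 - ν ^ 2) = m₀ * (1 + ν ^ 2) := by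
  obtain ⟨hM, hC, hSp, hI, hT, hR⟩ := hS
  obtain ⟨w, hw⟩ : ∃ w, w = (2 / (1 + ν ^ 2)) • u := ⟨_, rfl⟩
  rw [← hw]
  have hν : 0 < 1 + ν ^ 2 := by positivity
  have hν2 : ν ^ 2 < 1 := by nlinarith
  have hulen : eLen u = ν := eLen_eq hν0.le hu
  have hu0 : u ≠ 0 := by
    rintro rfl; rw [eLen_zero] at hulen; exact hν0.ne hulen
  have hwlen : eLen w < 1 := by
    rw [hw, eLen_smul hQ, hulen, abs_of_pos (by positivity), div_mul_eq_mul_div, div_lt_one hν]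
    nlinarith [pow_pos (sub_pos.2 hν1) 2]
  have hw0 : (0 : Fin n → Q) ≠ w := by
    rw [hw, ne_comm]; exact smul_ne_zero (by positivity) hu0
  obtain ⟨b, hb, c, hc, d, hd, ⟨hbc, q, hin, hout⟩, hvb, hvc, hrb, hrc⟩ :=
    hI k hk 0 w m₀ m₀ (by rw [eLen_zero]; exact one_pos) hwlen hw0 hm₀ hm₀
  have hbin : b ∈ S.inc k q := by rw [hin]; simp
  have hcin : c ∈ S.inc k q := by rw [hin]; simp
  have hdout : d ∈ S.out k q := by rw [hout]; simp
  obtain ⟨h, hh, f, hf, hev, ht, hline⟩ :=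
    exists_median_observer hQ hn hR hT hk q (u := u) (by rw [hu]; exact hν2)
  obtain ⟨hinh, houth⟩ := inc_out_eq (a := q - Coord.mk 1 u) hQ hn hN hk hh hf hev
    (by rw [sub_sub_cancel_left, msq_neg, msq_mk, hu]; linarith)
    (by rw [Coord.tm_sub, Coord.tm_mk]; linarith) ht
  obtain ⟨σ₁, hσ₁, ray₁⟩ := exists_backward_ray hQ (hb k hk) hbin hvb
  obtain ⟨σ₂, hσ₂, ray₂⟩ := exists_backward_ray hQ (hc k hk) hcin hvc
  set σ := min σ₁ σ₂ with hσ
  have hσ0 : 0 < σ := lt_min hσ₁ hσ₂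
  -- Halving keeps both `ε(1-ν²)` and `ε(1+ν²)` below `σ`, so both points stay on the world-lines.
  set ε := σ / 2 with hε
  have hε0 : 0 < ε := by positivity
  have hp1 : q - (ε * (1 - ν ^ 2)) • Coord.mk 1 0 ∈ S.wl k b := by
    refine ray₁ _ (mul_nonneg hε0.le (by linarith)) (le_trans ?_ (min_le_left σ₁ σ₂))
    nlinarith [sq_nonneg ν]
  have hp2 : q - (ε * (1 + ν ^ 2)) • Coord.mk 1 w ∈ S.wl k c := by
    refine ray₂ _ (mul_nonneg hε0.le hν.le) (le_trans ?_ (min_le_right σ₁ σ₂))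
    nlinarith
  -- The null parallelogram: one diagonal lies on the world-line of the median observer, the other
  -- joins a point of `b` to a point of `c`.
  set a := q - (ε * (1 - ν)) • Coord.mk 1 u with ha
  set e₁ : Coord Q n := (-(ε * (1 - ν))) • Coord.mk ν (-u) with he₁
  set e₂ : Coord Q n := (-(ε * (1 + ν))) • Coord.mk ν u with he₂
  have n1 : msq e₁ = 0 := by
    rw [he₁, msq_smul, msq_mk]; simp only [Pi.neg_apply, neg_sq, hu]; ring
  have n2 : msq e₂ = 0 := by
    rw [he₂, msq_smul, msq_mk, hu]; ring
  have n12 : mdot e₁ e₂ ≠ 0 := by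
    have : mdot (Coord.mk ν (-u)) (Coord.mk ν u) = 2 * ν ^ 2 := by
      have : mdot (Coord.mk ν (-u)) (Coord.mk ν u) = ν * ν - ∑ i, -u i * u i := rfl
      rw [this]
      simp only [neg_mul, Finset.sum_neg_distrib, ← sq, hu]; ring
    rw [he₁, he₂, mdot_smul_left, mdot_smul_right, this]
    have h1 : 1 - ν ≠ 0 := by linarith
    have h2 : 1 + ν ≠ 0 := by positivity
    exact mul_ne_zero (neg_ne_zero.2 (mul_ne_zero hε0.ne' h1))
      (mul_ne_zero (neg_ne_zero.2 (mul_ne_zero hε0.ne' h2)) (by positivity))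
  have eq1 : a + e₁ = q - (ε * (1 - ν ^ 2)) • Coord.mk 1 0 := by
    apply Coord.ext
    · simp only [ha, he₁, Coord.tm_add, Coord.tm_sub, Coord.tm_smul, Coord.tm_mk]; ring
    · simp only [ha, he₁, Coord.sp_add, Coord.sp_sub, Coord.sp_smul, Coord.sp_mk]; module
  have eq2 : a + e₂ = q - (ε * (1 + ν ^ 2)) • Coord.mk 1 w := by
    apply Coord.ext
    · simp only [ha, he₂, Coord.tm_add, Coord.tm_sub, Coord.tm_smul, Coord.tm_mk]; ring
    · simp only [ha, he₂, Coord.sp_add, Coord.sp_sub, Coord.sp_smul, Coord.sp_mk, hw, smul_smul]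
      rw [mul_assoc, mul_div_cancel₀ _ hν.ne']; module
  have eq3 : a + e₁ + e₂ = q - (ε * (1 + ν)) • Coord.mk 1 u := by
    apply Coord.ext
    · simp only [ha, he₁, he₂, Coord.tm_add, Coord.tm_sub, Coord.tm_smul, Coord.tm_mk]; ring
    · simp only [ha, he₁, he₂, Coord.sp_add, Coord.sp_sub, Coord.sp_smul, Coord.sp_mk]; module
  obtain ⟨htm, hsp⟩ := hf.map_parallelogram_time_axis n1 n2 n12 ((hline a).2 ⟨_, ha⟩)
    ((hline _).2 ⟨_, eq3⟩)
  rw [← eq1] at hp1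
  have hp2' := hp2
  rw [← eq2] at hp2'
  have hfp1 := (mem_wl_map hev b _).2 hp1
  have hfp2 := (mem_wl_map hev c _).2 hp2'
  have hq0 : (f q).sp = 0 := (hline q).2 ⟨0, by simp⟩
  have htq : (f (a + e₁)).tm ≠ (f q).tm := by
    have hbh : b ∈ S.inc h (f q) := by rw [hinh]; exact hbin
    rcases hbh.2 _ hfp1 with h1 | h1
    · exact h1.ne
    · have := f.injective h1
      rw [eq1, sub_eq_self, smul_eq_zero] at this
      rcases this with h2 | h2
      · have h3 : 0 < ε * (1 - ν ^ 2) := mul_pos hε0 (by linarith)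
        exact absurd h2 h3.ne'
      · exact absurd (congrFun h2 0) one_ne_zero
  obtain ⟨r, hr, hrq⟩ := exists_mem_lt_tm (hd k hk) hdout
  have hr0 := sp_eq_zero_of_symmetric_collision hQ hM hC hSp hh hb hc hd hbc
    (hinh.trans hin) (houth.trans hout) ⟨m₀, hrb, hrc⟩ hq0 hfp1 hfp2 htq htm hsp
    ((mem_wl_map hev d r).2 hr)
  obtain ⟨x, rfl⟩ := (hline r).1 hr0
  -- the center of mass according to `k`
  have hP1 := ray₁ σ hσ0.le (min_le_left _ _)
  have hP2 := ray₂ σ hσ0.le (min_le_right _ _)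
  have hkO := S.iob_subset_ob hk
  have hmb : S.MassAt k b (q - σ • Coord.mk 1 0) m₀ := hrb.2 k hkO (atRest_of_vel_zero hvb) _ hP1
  obtain ⟨m, hmc, -, -⟩ := hM k hkO c (q - σ • Coord.mk 1 w)
  have hm0 : 0 < m := massAt_pos hM hkO hP2 hmc
  have tm1 : ∀ v : Fin n → Q, (q - σ • Coord.mk 1 v).tm = q.tm - σ := by
    intro v; simp only [Coord.tm_sub, Coord.tm_smul, Coord.tm_mk, mul_one]
  have ne1 : ∀ v : Fin n → Q, (q - σ • Coord.mk 1 v).tm ≠ q.tm := by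
    intro v; rw [tm1]; linarith
  have hmm : m₀ + m ≠ 0 := by positivity
  have hcen : q - σ • Coord.mk 1 ((m / (m₀ + m)) • w) ∈ S.cen k b c := by
    refine ⟨q.tm - σ, _, _, m₀, m, ?_, ?_, hmb, hmc, hmm, ?_⟩
    · have := locAt_of_segment (hb k hk) hP1 hbin.1 (ne1 0) hP1
      rwa [tm1] at this
    · have := locAt_of_segment (hc k hk) hP2 hcin.1 (ne1 w) hP2
      rwa [tm1] at this
    · apply Coord.ext
      · simp only [Coord.tm_add, Coord.tm_sub, Coord.tm_smul, Coord.tm_mk]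
        change _ = (0 : Q)
        ring
      · simp only [Coord.sp_add, Coord.sp_sub, Coord.sp_smul, Coord.sp_mk]
        change _ = (0 : Fin n → Q)
        have : m • w = (m₀ + m) • (m / (m₀ + m)) • w := by
          rw [smul_smul, mul_div_cancel₀ _ hmm]
        have h2 : m • (q.sp - σ • (m / (m₀ + m)) • w - (q.sp - σ • w)) =
          σ • (m • w) - (σ * m) • (m / (m₀ + m)) • w := by module
        rw [h2, this]
        module
  -- The center-line, of velocity `m/(m₀+m) • w`, must continue into the world-line of `d`, of
  -- velocity `u`.
  obtain ⟨l, hl, hsub⟩ := hC k hk b hb c hc d hd ⟨hbc, q, hin, hout⟩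
  obtain ⟨y, hy⟩ := hl.exists_eq_add_smul (hsub (Or.inr hdout.1)) (hsub (Or.inr hr))
    (by intro h0; rw [← h0] at hrq; exact hrq.false) (hsub (Or.inl hcen))
  have hyt := congrArg Coord.tm hy
  have hys := congrArg Coord.sp hy
  simp only [Coord.tm_add, Coord.tm_sub, Coord.tm_smul, Coord.tm_mk] at hyt
  simp only [Coord.sp_add, Coord.sp_sub, Coord.sp_smul, Coord.sp_mk] at hys
  have hxy : y * x = σ := by linarith
  have hfin : (σ * (m / (m₀ + m) * (2 / (1 + ν ^ 2)))) • u = σ • u := by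
    have h1 : q.sp - σ • (m / (m₀ + m)) • w =
        q.sp - (σ * (m / (m₀ + m) * (2 / (1 + ν ^ 2)))) • u := by rw [hw]; module
    have h2 : q.sp + y • (q.sp - x • u - q.sp) = q.sp - (y * x) • u := by module
    rw [h1, h2, hxy] at hys
    exact sub_right_injective hys
  have hcoef := smul_left_injective Q hu0 hfin
  have hcoef' : m / (m₀ + m) * (2 / (1 + ν ^ 2)) = 1 :=
    mul_left_cancel₀ hσ0.ne' (hcoef.trans (mul_one σ).symm)
  refine ⟨c, hc, hrc, _, hP2, ?_, m, hmc, ?_⟩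
  · have := vel_eq_of_segment hQ (hc k hk) hP2 hcin.1 (ne1 w) hvc
    exact (velAt_iff_of_segment hQ (hc k hk) hP2 hcin.1 (ne1 w) this _ w).2 ⟨rfl, _, hP2, rfl⟩
  · field_simp at hcoef'
    linear_combination hcoef'

end DynModel

/-! ### The mass formula. -/

open DynModel in
theorem mainTheorem9 {Q : Type u} [Field Q] [LinearOrder Q] [IsStrictOrderedRing Q]
    (hQ : IsEuclideanField Q) {B : Type v} (n : ℕ) (hd : 3 ≤ n + 1) (S : DynModel Q n B)
    (hS : S.SpecRelDyn) (hN : S.NoFTLColliding)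
    (k : B) (hk : k ∈ S.IOb) (b : B) (hb : b ∈ S.IB) (m₀ : Q) (hm₀ : S.RestMass b m₀)
    (hslow : S.SlowerThanLight k b) :
    ∃ s m : Q, S.Speed k b s ∧ S.Mass k b m ∧ s ^ 2 ≤ 1 ∧ m₀ = eSqrt (1 - s ^ 2) * m := by
  have hn : 2 ≤ n := by omega
  have hkO := S.iob_subset_ob hk
  have hseg := hb k hk
  obtain ⟨p, hp, q, hq, hpq⟩ := hseg.2.2
  have hpos : 0 < |p.tm - q.tm| := (eLen_nonneg hQ _).trans_lt (hslow p hp q hq hpq)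
  have hsub : p.tm - q.tm ≠ 0 := abs_pos.1 hpos
  have hne : p.tm ≠ q.tm := sub_ne_zero.1 hsub
  set w := (p.tm - q.tm)⁻¹ • (p.sp - q.sp) with hw
  have hw' : p.sp - q.sp = (p.tm - q.tm) • w := by rw [hw, smul_inv_smul₀ hsub]
  have hvel := velAt_iff_of_segment hQ hseg hp hq hne hw'
  have hV : S.Vel k b w := ⟨⟨p.tm, (hvel _ _).2 ⟨rfl, p, hp, rfl⟩⟩, fun t w' h => ((hvel t w').1 h).1⟩
  have hlt : eLen w < 1 := by
    have h1 := hslow p hp q hq hpq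
    rw [hw', eLen_smul hQ] at h1
    exact lt_of_mul_lt_mul_left (by rwa [mul_one]) hpos.le
  have h0 := eLen_nonneg hQ w
  have hsq : eLen w ^ 2 < 1 := by nlinarith
  have hm0 := restMass_pos hS.1 hm₀
  -- A resting body is treated apart, since the collision needs two distinct velocities.
  rcases h0.eq_or_lt with hz | hwpos
  · have hwz := eq_zero_of_eLen_eq_zero hQ hz.symm
    rw [hwz] at hV
    refine ⟨0, m₀, ⟨0, hV, eLen_zero.symm⟩, ⟨⟨p, hp⟩, hm₀.2 k hkO (atRest_of_vel_zero hV)⟩, ?_, ?_⟩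
    · simp
    · rw [eSqrt_eq zero_le_one (by ring), one_mul]
  · set s := eLen w with hs
    obtain ⟨hr0, hrr⟩ := eSqrt_spec hQ (sub_nonneg.2 hsq.le)
    set r := eSqrt (1 - s ^ 2) with hr
    have h1r : 0 < 1 + r := by positivity
    have hrpos : 0 < r := lt_of_le_of_ne hr0 (by intro h; rw [← h] at hrr; linarith)
    -- The median speed: the root below 1 of `s = 2ν/(1+ν²)`. It makes `(1-ν²)/(1+ν²)` equal to `r`.
    set ν := s / (1 + r) with hν
    have hν2 : ν ^ 2 * (1 + r) = 1 - r := by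
      rw [hν]; field_simp; linear_combination hrr
    have hν1 : 1 + ν ^ 2 = 2 / (1 + r) := by
      rw [eq_div_iff h1r.ne']; linear_combination hν2
    obtain ⟨c, hc, hrc, z, hz, hvz, m, hmz, hm⟩ := exists_moving_mass hQ hn hS hN hk hm0
      (u := (1 + r)⁻¹ • w) (ν := ν) (by positivity) (by rw [hν, div_lt_one h1r]; linarith) (by
        rw [← eLen_sq hQ, eLen_smul hQ, abs_of_pos (by positivity), hν, div_eq_inv_mul])
    have hwz : (2 / (1 + ν ^ 2)) • (1 + r)⁻¹ • w = w := by
      rw [hν1, smul_smul]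
      convert one_smul Q w
      field_simp
    rw [hwz] at hvz
    refine ⟨s, m, ⟨w, hV, rfl⟩, ⟨⟨p, hp⟩, fun x hx => ?_⟩, hsq.le, ?_⟩
    -- `AxSpeed` compares each point of `b` with the one point where the mass of `c` was computed,
    -- so the mass of `b` is constant.
    · obtain ⟨y, hy, hy'⟩ := hS.2.2.1 k hk b hb c hc x z hx hz ⟨m₀, hm₀, hrc⟩
        ⟨s, ⟨w, (hvel _ _).2 ⟨rfl, x, hx, rfl⟩, rfl⟩, ⟨w, hvz, rfl⟩⟩
      rwa [← hmz.2 y hy'.1]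
    · have h2 : 1 - ν ^ 2 = 2 * r / (1 + r) := by
        rw [eq_div_iff h1r.ne']; linear_combination -hν2
      rw [hν1, h2] at hm
      field_simp at hm
      linarith
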